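/- There are universal constants $C,c>0$ such that the following holds. Let $d,k\in\mathbb N$ and let $D$ be a joint distribution of $(\mathbf x,y)$ supported on $\mathbb R^d\times\{\pm1\}$ whose $\mathbf x$-marginal is the standard Gaussian $\mathcal N(\mathbf 0,\mathbf I_d)$. Let $p:\mathbb R\to\mathbb R$ be a polynomial of degree at most $k$ with mean zero and variance one under $\mathcal N(0,1)$, and suppose that for some unit vector $\mathbf v^*\in\mathbb R^d$ and some $\tau\in(0,1]$, $$\mathbf E_{(\mathbf x,y)\sim D}\big[\mathbf 1(y=-1)\,p(\langle\mathbf v^*,\mathbf x\rangle)\big]\ge\tau .$$ For $m\ge 1$ let $\mathbf H_m(\mathbf x)$ be the normalized Hermite tensor, with entries $$(\mathbf H_m(\mathbf x))_{i_1,\dots,i_m}=\frac1{\sqrt{m!}}\sum_P\ \prod_{\{a,b\}\in P}(-\mathbf I_{i_a,i_b})\prod_{\{c\}\in P}\mathbf x_{i_c},$$ where $P$ ranges over the partitions of $\{1,\dots,m\}$ into sets of size 1 and 2, and let $\mathbf T^m=\mathbf E_{(\mathbf x,y)\sim D}[\mathbf 1(y=-1)\mathbf H_m(\mathbf x)]$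 be the order-$m$ Chow-parameter tensor. For $m=1,\dots,k$ let $\mathbf T'^m$ be any order-$m$ tensor with $\|\mathbf T'^m-\mathbf T^m\|_F\le\tau/(4\sqrt k)$, let $V_m\subseteq\mathbb R^d$ be the span of the left singular vectors, with singular values greater than $\tau/(4\sqrt k)$, of $\mathbf T'^m$ flattened to a $d\times d^{m-1}$ matrix (rows indexed by the first index), and let $V=V_1+\dots+V_k$. Put $\gamma=\Pr_{(\mathbf x,y)\sim D}[y=-1]$ and $L=\max\{1,\log(1/\gamma)\}$, where $\log$ is the natural logarithm. Then 1. $\dim V\le C\left(\gamma^2L^kk^2/\tau^2+1\right)$, and 2. $\|\mathrm{proj}_V\mathbf v^*\|_2\ge c\,\tau/\left(\sqrt k\,\gamma\,L^{k/2}\right)$. -/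

import Mathlib

open MeasureTheory ProbabilityTheory

noncomputable section

/-- The space `ℝ^d` with its Euclidean norm. -/
abbrev Vec (d : ℕ) : Type := EuclideanSpace ℝ (Fin d)

/-- Real tensors of order `m` on `ℝ^d`, given by their entries. -/
abbrev Tensor (d m : ℕ) : Type := (Fin m → Fin d) → ℝ

/-- The Frobenius norm of a tensor. -/
def Tensor.frobNorm {d m : ℕ} (T : Tensor d m) : ℝ :=
  √(∑ i, T i ^ 2)

/-- The factor contributed by a block `B` of size 1 or 2 to the entry with multi-index `i` of a
Hermite tensor: `x_{i_c}` for `B = {c}`, and `-I_{i_a, i_b}` (that is, `-1` if `i_a = i_b` and `0`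
otherwise) for `B = {a, b}`. -/
def hermiteBlock {d m : ℕ} (x : Vec d) (i : Fin m → Fin d) (B : Finset (Fin m)) : ℝ :=
  if B.card = 1 then ∏ c ∈ B, x (i c)
  else -(if ∀ a ∈ B, ∀ b ∈ B, i a = i b then 1 else 0)

/-- The normalized Hermite tensor `H_m(x)`: its entry with multi-index `i` is `1 / √(m!)` times the
sum, over all partitions of the `m` positions into blocks of size 1 and 2 (the blocks of a
`Finpartition` are never empty), of the product of the factors of the blocks. -/
def hermiteTensor {d : ℕ} (m : ℕ) (x : Vec d) : Tensor d m := fun i =>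
  1 / √(m.factorial : ℝ) *
    ∑ P : Finpartition (Finset.univ : Finset (Fin m)) with ∀ B ∈ P.parts, B.card ≤ 2,
      ∏ B ∈ P.parts, hermiteBlock x i B

/-- The indicator `1(y = -1)` of the negative label. -/
def negInd (y : ℝ) : ℝ := if y = -1 then 1 else 0

/-- The order-`m` Chow-parameter tensor `E_{(x,y) ∼ D}[1(y = -1) H_m(x)]`. -/
def chowTensor {d : ℕ} (D : Measure (Vec d × ℝ)) (m : ℕ) : Tensor d m := fun i =>
  ∫ z, negInd z.2 * hermiteTensor m z.1 i ∂D

/-- The flattening of a tensor of order `n + 1` to a matrix with `d` rows and `d ^ n` columns: the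
first index is the row, the remaining `n` indices form the column. -/
def Tensor.flatten {d n : ℕ} (T : Tensor d (n + 1)) : Matrix (Fin d) (Fin n → Fin d) ℝ :=
  fun r c => T (Fin.cons r c)

/-- `u` is a left singular vector of `A` with singular value `σ`: there is a right singular
vector `w` such that `(σ, u, w)` is a singular triple of `A`. -/
def IsLeftSingularVector {d : ℕ} {ι : Type} [Fintype ι] [DecidableEq ι]
    (A : Matrix (Fin d) ι ℝ) (σ : ℝ) (u : Vec d) : Prop :=
  0 ≤ σ ∧ ‖u‖ = 1 ∧ ∃ w : EuclideanSpace ℝ ι, ‖w‖ = 1 ∧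
    A.toEuclideanLin w = σ • u ∧ A.transpose.toEuclideanLin u = σ • w

/-- The span of the left singular vectors of `A` whose singular values are greater than `θ`. -/
def topLeftSingularSpan {d : ℕ} {ι : Type} [Fintype ι] [DecidableEq ι]
    (A : Matrix (Fin d) ι ℝ) (θ : ℝ) : Submodule ℝ (Vec d) :=
  Submodule.span ℝ {u | ∃ σ, θ < σ ∧ IsLeftSingularVector A σ u}

/-- The subspace generated by the spaces `V_1, …, V_k`, where `V_m` is the span of the left singular
vectors, with singular values greater than `θ`, of the flattened tensor `T m`
(here `m = n + 1` with `n < k`). -/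
def chowSubspace {d : ℕ} (T : (m : ℕ) → Tensor d m) (k : ℕ) (θ : ℝ) : Submodule ℝ (Vec d) :=
  ⨆ n : Fin k, topLeftSingularSpan (T (n + 1)).flatten θ

end

/-! Expand `p` in normalized Hermite polynomials, with coefficients `b_m` for `1 ≤ m ≤ k` and `∑
b_m² = 1`; the constant term vanishes because the mean does. For a unit vector `v`, the degree-`m`
Hermite polynomial of `⟨v, x⟩` is the pairing of `H_m(x)` with `v^{⊗m}`, so the correlation of `p`
with the negative label is `∑ b_m ⟨v^{⊗m}, T^m⟩` (`exists_integral_eq_sum_chowTensor`).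

The analytic input is the level inequality `‖T^m‖_F² ≤ e³ γ² L^m` (`frobNorm_chowTensor_sq_le`).
Contracting `T^m` with `H_m` gives a Gaussian chaos `G` with `E[1(y = -1) G] = ‖T^m‖_F²`.
Hypercontractivity (`gaussianExp_sqContract_le`) bounds the moment of `G` of order `2q + 2`, and
Young's inequality with `q` about `L / 2` turns this into a bound of order `γ` on the correlation
with an event of probability `γ`.

The rest is linear algebra. Put `θ = τ / (4√k)` and let `B` bound all `‖T^m‖_F`. On `Vᗮ` every
flattened `T'^m` has norm at most `θ`, so only the component of `v` in `V` can carry the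
correlation: `τ ≤ √k (3θ + B ‖proj_V v‖)`, and `3θ√k = 3τ/4` is absorbed (`correlation_le`). Each
`V_m` has dimension at most `‖T'^m‖_F² / θ²`, since the squared singular values sum to the squared
Frobenius norm (`finrank_chowSubspace_le`). -/

section HermitePolynomials

/-! ### Hermite polynomials in one and several variables. -/

open Polynomial in
/-- The probabilists' Hermite polynomials, with real coefficients. -/
noncomputable def realHermite (n : ℕ) : Polynomial ℝ := (hermite n).map (Int.castRingHom ℝ)

open Polynomial in
lemma realHermite_zero : realHermite 0 = 1 := by simp [realHermite]

open Polynomial in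
lemma realHermite_succ (n : ℕ) :
    realHermite (n + 1) = X * realHermite n - derivative (realHermite n) := by
  simp [realHermite, hermite_succ, derivative_map]

open Polynomial in
lemma derivative_realHermite_succ (n : ℕ) :
    derivative (realHermite (n + 1)) = ((n : Polynomial ℝ) + 1) * realHermite n := by
  induction n with
  | zero => simp [realHermite_succ, realHermite_zero]
  | succ n ih =>
    rw [realHermite_succ (n + 1), derivative_sub, derivative_mul, ih, derivative_mul]
    have := realHermite_succ n
    simp only [derivative_X, derivative_add, derivative_natCast, derivative_one]
    push_cast
    rw [this]
    ring

lemma natDegree_realHermite (n : ℕ) : (realHermite n).natDegree = n := by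
  rw [realHermite, (Polynomial.hermite_monic n).natDegree_map, Polynomial.natDegree_hermite]

lemma realHermite_monic (n : ℕ) : (realHermite n).Monic :=
  (Polynomial.hermite_monic n).map _

variable {d : ℕ}

/-- The product `∏ l, He_{n l}(X_l)` of Hermite polynomials in different variables. -/
noncomputable def hermPoly (n : Fin d → ℕ) : MvPolynomial (Fin d) ℝ :=
  ∏ l, Polynomial.aeval (MvPolynomial.X l : MvPolynomial (Fin d) ℝ) (realHermite (n l))

lemma hermPoly_zero : hermPoly (0 : Fin d → ℕ) = 1 := by
  simp [hermPoly, realHermite_zero]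

/-- The factors of `hermPoly n` in the variables other than `X_l`. -/
noncomputable def hermPolyRest (l : Fin d) (n : Fin d → ℕ) : MvPolynomial (Fin d) ℝ :=
  ∏ l' ∈ Finset.univ.erase l,
    Polynomial.aeval (MvPolynomial.X l' : MvPolynomial (Fin d) ℝ) (realHermite (n l'))

lemma hermPoly_eq_mul_rest (l : Fin d) (n : Fin d → ℕ) :
    hermPoly n = Polynomial.aeval (MvPolynomial.X l) (realHermite (n l)) * hermPolyRest l n :=
  (Finset.mul_prod_erase _ _ (Finset.mem_univ l)).symm

lemma hermPolyRest_congr (l : Fin d) {n n' : Fin d → ℕ} (h : ∀ l', l' ≠ l → n l' = n' l') :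
    hermPolyRest l n = hermPolyRest l n' :=
  Finset.prod_congr rfl fun l' hl' => by rw [h l' (Finset.ne_of_mem_erase hl')]

lemma pderiv_hermPolyRest (l : Fin d) (n : Fin d → ℕ) :
    MvPolynomial.pderiv l (hermPolyRest l n) = 0 := by
  refine Finset.prod_induction _ (fun p => MvPolynomial.pderiv l p = 0) ?_ ?_ ?_
  · intro a b ha hb
    simp [Derivation.leibniz, ha, hb]
  · simp
  · intro l' hl'
    rw [Derivation.map_aeval, MvPolynomial.pderiv_X_of_ne (Finset.ne_of_mem_erase hl'), smul_zero]

lemma pderiv_hermPoly_eq_mul_rest (l : Fin d) (n : Fin d → ℕ) :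
    MvPolynomial.pderiv l (hermPoly n) =
      Polynomial.aeval (MvPolynomial.X l) (Polynomial.derivative (realHermite (n l))) *
        hermPolyRest l n := by
  rw [hermPoly_eq_mul_rest l, Derivation.leibniz, pderiv_hermPolyRest, Derivation.map_aeval,
    MvPolynomial.pderiv_X_self]
  simp [mul_comm]

/-- Raising an index applies the creation operator `X_l - ∂_l`. -/
lemma hermPoly_add_single (l : Fin d) (n : Fin d → ℕ) :
    hermPoly (n + Pi.single l 1) =
      MvPolynomial.X l * hermPoly n - MvPolynomial.pderiv l (hermPoly n) := by
  rw [pderiv_hermPoly_eq_mul_rest, hermPoly_eq_mul_rest l, hermPoly_eq_mul_rest l n,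
    hermPolyRest_congr l (n := n + Pi.single l 1) (n' := n)
      (fun l' h => by simp [Pi.single_eq_of_ne h])]
  simp only [Pi.add_apply, Pi.single_eq_same, realHermite_succ, map_sub, map_mul,
    Polynomial.aeval_X]
  ring

/-- Differentiation lowers an index. -/
lemma pderiv_hermPoly (l : Fin d) (n : Fin d → ℕ) :
    MvPolynomial.pderiv l (hermPoly n) = (n l : MvPolynomial (Fin d) ℝ) *
      hermPoly (n - Pi.single l 1) := by
  rw [pderiv_hermPoly_eq_mul_rest, hermPoly_eq_mul_rest l (n - Pi.single l 1),
    hermPolyRest_congr l (n := n - Pi.single l 1) (n' := n)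
      (fun l' h => by simp [Pi.single_eq_of_ne h])]
  rcases hn : n l with _ | k
  · simp [realHermite_zero]
  · simp [derivative_realHermite_succ, hn, mul_assoc]

end HermitePolynomials

/-! ### Sums over partitions into blocks of size at most two. -/

section PartitionSums

variable {α : Type} [DecidableEq α]

/-- The sum, over the partitions of `S` into blocks of size at most 2, of the product of the
weights of the blocks. -/
def blockSum (w : Finset α → ℝ) (S : Finset α) : ℝ :=
  ∑ P : Finpartition S with ∀ B ∈ P.parts, B.card ≤ 2, ∏ B ∈ P.parts, w B

lemma blockSum_empty (w : Finset α → ℝ) : blockSum w ∅ = 1 := by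
  have h : ∀ P : Finpartition (∅ : Finset α), P.parts = ∅ := fun P =>
    P.parts_eq_empty_iff.2 rfl
  have hu : Subsingleton (Finpartition (∅ : Finset α)) :=
    ⟨fun P Q => Finpartition.ext (by rw [h P, h Q])⟩
  have : (Finset.univ.filter fun P : Finpartition (∅ : Finset α) => ∀ B ∈ P.parts, B.card ≤ 2) =
      {Finpartition.empty (Finset α)} := by
    ext P
    simp [Subsingleton.elim P (Finpartition.empty (Finset α))]
  rw [blockSum, this, Finset.sum_singleton, h, Finset.prod_empty]

lemma avoid_parts_of_mem {U B : Finset α} (P : Finpartition U) (hB : B ∈ P.parts) :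
    (P.avoid B).parts = P.parts.erase B := by
  ext A
  rw [Finpartition.mem_avoid, Finset.mem_erase]
  constructor
  · rintro ⟨A', hA', hle, rfl⟩
    have hne : A' ≠ B := fun h => hle h.le
    have hd : Disjoint A' B := P.disjoint hA' hB hne
    rw [Finset.sdiff_eq_self_of_disjoint hd]
    exact ⟨hne, hA'⟩
  · rintro ⟨hne, hA⟩
    have hd : Disjoint A B := P.disjoint hA hB hne
    refine ⟨A, hA, fun h => ?_, Finset.sdiff_eq_self_of_disjoint hd⟩
    exact P.ne_bot hA (hd.eq_bot_of_le h)

/-- The partitions in which the block of `a` is `B`. -/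
lemma sum_part_eq (w : Finset α → ℝ) {U B : Finset α} {a : α} (haB : a ∈ B) (hBU : B ⊆ U)
    (hcard : B.card ≤ 2) :
    ∑ P ∈ (Finset.univ.filter fun P : Finpartition U => ∀ B ∈ P.parts, B.card ≤ 2) with
      P.part a = B, ∏ A ∈ P.parts, w A = w B * blockSum w (U \ B) := by
  have hne : B ≠ ⊥ := Finset.ne_empty_of_mem haB
  have hd : Disjoint (U \ B) B := Finset.sdiff_disjoint
  have hc : (U \ B) ⊔ B = U := Finset.sdiff_union_of_subset hBU
  have hmem : ∀ P : Finpartition U, P.part a = B → B ∈ P.parts := fun P h =>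
    h ▸ P.part_mem.2 (hBU haB)
  have hnot : ∀ Q : Finpartition (U \ B), B ∉ Q.parts := fun Q h =>
    hne (hd.symm.eq_bot_of_le (Q.le h))
  rw [blockSum, Finset.mul_sum]
  refine Finset.sum_bij' (fun P _ => P.avoid B) (fun Q _ => Q.extend hne hd hc) ?_ ?_ ?_ ?_ ?_
  · intro P hP
    simp only [Finset.mem_filter, Finset.mem_univ, true_and] at hP ⊢
    intro A hA
    rw [avoid_parts_of_mem P (hmem P hP.2)] at hA
    exact hP.1 A (Finset.mem_of_mem_erase hA)
  · intro Q hQ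
    simp only [Finset.mem_filter, Finset.mem_univ, true_and] at hQ ⊢
    refine ⟨fun A hA => ?_, ?_⟩
    · rw [Finpartition.extend_parts, Finset.mem_insert] at hA
      rcases hA with rfl | hA
      · exact hcard
      · exact hQ A hA
    · exact Finpartition.part_eq_of_mem _ (by simp [Finpartition.extend_parts]) haB
  · intro P hP
    simp only [Finset.mem_filter, Finset.mem_univ, true_and] at hP
    apply Finpartition.ext
    rw [Finpartition.extend_parts, avoid_parts_of_mem P (hmem P hP.2),
      Finset.insert_erase (hmem P hP.2)]
  · intro Q hQ
    apply Finpartition.ext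
    rw [avoid_parts_of_mem _ (by simp [Finpartition.extend_parts]), Finpartition.extend_parts,
      Finset.erase_insert (hnot Q)]
  · intro P hP
    simp only [Finset.mem_filter, Finset.mem_univ, true_and] at hP
    rw [avoid_parts_of_mem P (hmem P hP.2), Finset.mul_prod_erase _ _ (hmem P hP.2)]

/-- The block of `a` is either `{a}` or a pair `{a, c}`; removing it leaves an arbitrary admissible
partition of the remaining points. -/
lemma blockSum_insert (w : Finset α → ℝ) {a : α} {S : Finset α} (ha : a ∉ S) :
    blockSum w (insert a S) =
      w {a} * blockSum w S + ∑ c ∈ S, w {a, c} * blockSum w (S.erase c) := by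
  have hmaps : ∀ P ∈ (Finset.univ.filter fun P : Finpartition (insert a S) =>
      ∀ B ∈ P.parts, B.card ≤ 2), P.part a ∈ insert {a} (S.image fun c => ({a, c} : Finset α)) := by
    intro P hP
    simp only [Finset.mem_filter, Finset.mem_univ, true_and] at hP
    have haU : a ∈ insert a S := Finset.mem_insert_self a S
    have h1 : a ∈ P.part a := P.mem_part_self.2 haU
    have h2 := hP _ (P.part_mem.2 haU)
    rw [Finset.mem_insert, Finset.mem_image]
    by_cases hs : P.part a = {a}
    · exact Or.inl hs
    · right
      obtain ⟨c, hc, hca⟩ : ∃ c ∈ P.part a, c ≠ a := by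
        by_contra! hcon
        exact hs (Finset.eq_singleton_iff_unique_mem.2 ⟨h1, hcon⟩)
      refine ⟨c, ?_, ?_⟩
      · exact Finset.mem_of_mem_insert_of_ne (P.part_subset a hc) hca
      · apply Finset.eq_of_subset_of_card_le
        · intro t ht
          rcases Finset.mem_insert.1 ht with rfl | ht
          · exact h1
          · rw [Finset.mem_singleton.1 ht]; exact hc
        · rw [Finset.card_pair hca.symm]; exact h2
  rw [blockSum, ← Finset.sum_fiberwise_of_maps_to hmaps, Finset.sum_insert, Finset.sum_image]
  · congr 1
    · rw [sum_part_eq w (Finset.mem_singleton_self a) (by simp) (by simp)]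
      congr 2
      ext t; simp only [Finset.mem_sdiff, Finset.mem_insert, Finset.mem_singleton]
      constructor
      · tauto
      · intro h; exact ⟨Or.inr h, fun h' => ha (h' ▸ h)⟩
    · refine Finset.sum_congr rfl fun c hc => ?_
      have hac : a ≠ c := fun h => ha (h ▸ hc)
      rw [sum_part_eq w (Finset.mem_insert_self a {c})
        (by intro t; simp only [Finset.mem_insert, Finset.mem_singleton]; rintro (rfl | rfl) <;> tauto)
        (Finset.card_pair hac).le]
      congr 2
      ext t; simp only [Finset.mem_sdiff, Finset.mem_insert, Finset.mem_singleton, Finset.mem_erase]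
      constructor
      · tauto
      · rintro ⟨h, h'⟩; exact ⟨Or.inr h', fun h'' => h''.elim (fun h3 => ha (h3 ▸ h')) h⟩
  · intro c hc c' hc' h
    have hac : c ≠ a := fun h => ha (h ▸ hc)
    have : c ∈ ({a, c'} : Finset α) := by
      have : ({a, c} : Finset α) = {a, c'} := h
      rw [← this]; simp
    simpa [hac] using this
  · rw [Finset.mem_image]
    rintro ⟨c, hc, h⟩
    have : c ∈ ({a} : Finset α) := by rw [← h]; simp
    exact ha (Finset.mem_singleton.1 this ▸ hc)

end PartitionSums

/-! ### Entries of Hermite tensors as products of Hermite polynomials. -/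

section HermiteTensors

variable {d m : ℕ}

/-- The number of occurrences of each index at the positions in `S`. -/
def countOn (i : Fin m → Fin d) (S : Finset (Fin m)) : Fin d → ℕ :=
  fun l => (S.filter fun c => i c = l).card

/-- The number of occurrences of each index in a multi-index. -/
def indexCount (i : Fin m → Fin d) : Fin d → ℕ := countOn i Finset.univ

lemma countOn_insert (i : Fin m → Fin d) {a : Fin m} {S : Finset (Fin m)} (ha : a ∉ S) :
    countOn i (insert a S) = countOn i S + Pi.single (i a) 1 := by
  funext l
  simp only [countOn, Finset.filter_insert, Pi.add_apply]
  by_cases h : i a = l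
  · subst h
    rw [if_pos rfl, Finset.card_insert_of_notMem (by simp [ha]), Pi.single_eq_same]
  · rw [if_neg h, Pi.single_eq_of_ne (Ne.symm h), add_zero]

lemma countOn_erase (i : Fin m → Fin d) {c : Fin m} {S : Finset (Fin m)} (hc : c ∈ S) :
    countOn i (S.erase c) = countOn i S - Pi.single (i c) 1 := by
  conv_rhs => rw [← Finset.insert_erase hc, countOn_insert i (Finset.notMem_erase c S)]
  simp

/-- Both sides obey the same recursion when a position `a` is added: a singleton block multiplies by
`X_l` with `l = i a`, and the pairs containing `a` produce `-∂_l`. -/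
lemma blockSum_hermiteBlock (x : Vec d) (i : Fin m → Fin d) (S : Finset (Fin m)) :
    blockSum (hermiteBlock x i) S = MvPolynomial.eval x.ofLp (hermPoly (countOn i S)) := by
  induction S using Finset.strongInduction with
  | H S ih =>
    rcases S.eq_empty_or_nonempty with rfl | ⟨a, haS⟩
    · have : countOn i ∅ = 0 := by funext l; simp [countOn]
      rw [blockSum_empty, this, hermPoly_zero, map_one]
    · obtain ⟨S, haS', rfl⟩ : ∃ S', a ∉ S' ∧ S = insert a S' :=
        ⟨S.erase a, Finset.notMem_erase a S, (Finset.insert_erase haS).symm⟩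
      have hss : S ⊂ insert a S := Finset.ssubset_insert haS'
      rw [blockSum_insert _ haS', ih S hss, countOn_insert i haS', hermPoly_add_single,
        pderiv_hermPoly, map_sub, map_mul, map_mul, MvPolynomial.eval_X, map_natCast, sub_eq_add_neg]
      congr 1
      · simp [hermiteBlock]
      -- Only positions `c` with `i c = i a` contribute. Their number is the factor that
      -- differentiation brings down.
      · have hterm : ∀ c ∈ S, hermiteBlock x i {a, c} * blockSum (hermiteBlock x i) (S.erase c) =
            if i c = i a then
              -MvPolynomial.eval x.ofLp (hermPoly (countOn i S - Pi.single (i a) 1)) else 0 := by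
          intro c hc
          have hac : a ≠ c := fun h => haS' (h ▸ hc)
          rw [ih _ ((Finset.erase_ssubset hc).trans hss), countOn_erase i hc, hermiteBlock,
            if_neg (by rw [Finset.card_pair hac]; norm_num)]
          by_cases h : i c = i a
          · simp [h]
          · simp [h]
        rw [Finset.sum_congr rfl hterm, ← Finset.sum_filter, Finset.sum_const, nsmul_eq_mul,
          mul_neg]
        rfl

lemma hermiteTensor_eq (x : Vec d) (i : Fin m → Fin d) :
    hermiteTensor m x i =
      1 / √(m.factorial : ℝ) * MvPolynomial.eval x.ofLp (hermPoly (indexCount i)) := by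
  rw [indexCount, ← blockSum_hermiteBlock, hermiteTensor, blockSum]
  congr!

lemma indexCount_cons (l : Fin d) (i : Fin m → Fin d) :
    indexCount (Fin.cons l i : Fin (m + 1) → Fin d) = indexCount i + Pi.single l 1 := by
  funext l'
  simp only [indexCount, countOn, Pi.add_apply, Finset.card_filter, Fin.sum_univ_succ,
    Fin.cons_zero, Fin.cons_succ, Pi.single_apply]
  rw [add_comm]
  simp [eq_comm]

lemma indexCount_insertNth (c : Fin (m + 1)) (l : Fin d) (i : Fin m → Fin d) :
    indexCount (c.insertNth l i : Fin (m + 1) → Fin d) = indexCount i + Pi.single l 1 := by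
  funext l'
  simp only [indexCount, countOn, Pi.add_apply, Finset.card_filter, Fin.sum_univ_succAbove _ c,
    Fin.insertNth_apply_same, Fin.insertNth_apply_succAbove, Pi.single_apply]
  rw [add_comm]
  simp [eq_comm]

end HermiteTensors

/-! ### Gaussian integration by parts for polynomials. -/

section GaussianIntegrals

lemma integrable_pow_gaussianReal (n : ℕ) :
    Integrable (fun t : ℝ => t ^ n) (gaussianReal 0 1) := by
  have h : MemLp (id : ℝ → ℝ) (n : ENNReal) (gaussianReal 0 1) := by
    simpa using memLp_id_gaussianReal (μ := 0) (v := 1) (n : NNReal)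
  refine (h.integrable_norm_pow' ).mono' (by fun_prop) ?_
  exact Filter.Eventually.of_forall fun t => by simp

lemma integrable_eval_gaussianReal (p : Polynomial ℝ) :
    Integrable (fun t : ℝ => p.eval t) (gaussianReal 0 1) := by
  simp_rw [Polynomial.eval_eq_sum_range]
  exact integrable_finsetSum _ fun n _ => (integrable_pow_gaussianReal n).const_mul _

lemma integrable_eval_mul_gaussianPDFReal (p : Polynomial ℝ) :
    Integrable (fun t : ℝ => p.eval t * gaussianPDFReal 0 1 t) := by
  have h := integrable_eval_gaussianReal p
  rw [gaussianReal_of_var_ne_zero 0 one_ne_zero, integrable_withDensity_iff_integrable_smul'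
    (measurable_gaussianPDF 0 1) (Filter.Eventually.of_forall fun _ => gaussianPDF_lt_top)] at h
  refine h.congr (Filter.Eventually.of_forall fun t => ?_)
  simp [mul_comm]

lemma hasDerivAt_gaussianPDFReal (t : ℝ) :
    HasDerivAt (gaussianPDFReal 0 1) (-(t * gaussianPDFReal 0 1 t)) t := by
  have h1 : HasDerivAt (fun x : ℝ => -(x - 0) ^ 2 / (2 * ((1 : NNReal) : ℝ))) (-t) t := by
    have := ((hasDerivAt_pow 2 t).neg).div_const 2
    refine (this.congr_deriv (by simp; ring)).congr_of_eventuallyEq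
      (Filter.Eventually.of_forall fun x => by simp)
  have h2 := (h1.exp).const_mul (√(2 * Real.pi * ((1 : NNReal) : ℝ)))⁻¹
  rw [gaussianPDFReal_def]
  exact h2.congr_deriv (by ring)

/-- Integration by parts against the standard Gaussian on the line. -/
lemma integral_mul_eval_gaussianReal (p : Polynomial ℝ) :
    ∫ t, t * p.eval t ∂(gaussianReal 0 1) =
      ∫ t, (Polynomial.derivative p).eval t ∂(gaussianReal 0 1) := by
  rw [integral_gaussianReal_eq_integral_smul one_ne_zero,
    integral_gaussianReal_eq_integral_smul one_ne_zero]
  have h := integral_mul_deriv_eq_deriv_mul_of_integrable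
    (u := fun t => p.eval t) (u' := fun t => (Polynomial.derivative p).eval t)
    (v := gaussianPDFReal 0 1) (v' := fun t => -(t * gaussianPDFReal 0 1 t))
    (fun t _ => p.hasDerivAt t) (fun t _ => hasDerivAt_gaussianPDFReal t)
    (by
      refine (integrable_eval_mul_gaussianPDFReal (-(Polynomial.X * p))).congr
        (Filter.Eventually.of_forall fun t => ?_)
      simp only [Polynomial.eval_neg, Polynomial.eval_mul, Polynomial.eval_X, Pi.mul_apply]
      ring)
    (integrable_eval_mul_gaussianPDFReal _) (integrable_eval_mul_gaussianPDFReal _)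
  simp only [smul_eq_mul]
  have h2 : ∫ t, p.eval t * -(t * gaussianPDFReal 0 1 t) =
      -∫ t, gaussianPDFReal 0 1 t * (t * p.eval t) := by
    rw [← integral_neg]; congr 1; funext t; ring
  rw [h2, neg_inj] at h
  rw [h]
  congr 1; funext t; ring

/-- The moments of the standard Gaussian. -/
noncomputable def gaussianMoment (n : ℕ) : ℝ := ∫ t, t ^ n ∂(gaussianReal 0 1)

lemma gaussianMoment_succ (n : ℕ) : gaussianMoment (n + 1) = n * gaussianMoment (n - 1) := by
  have h := integral_mul_eval_gaussianReal (Polynomial.X ^ n)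
  simp only [Polynomial.eval_pow, Polynomial.eval_X, Polynomial.derivative_X_pow,
    Polynomial.eval_mul, Polynomial.eval_C, integral_const_mul] at h
  simpa [gaussianMoment, pow_succ'] using h

variable {d : ℕ}

lemma integral_stdGaussian_eq_pi (f : Vec d → ℝ) :
    ∫ x, f x ∂(stdGaussian (Vec d)) =
      ∫ x, f (WithLp.toLp 2 x) ∂(Measure.pi fun _ : Fin d => gaussianReal 0 1) := by
  rw [← map_pi_eq_stdGaussian]
  exact integral_map_equiv (MeasurableEquiv.toLp 2 (Fin d → ℝ)) f

lemma integrable_stdGaussian_iff_pi (f : Vec d → ℝ) :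
    Integrable f (stdGaussian (Vec d)) ↔
      Integrable (fun x => f (WithLp.toLp 2 x))
        (Measure.pi fun _ : Fin d => gaussianReal 0 1) := by
  rw [← map_pi_eq_stdGaussian]
  exact integrable_map_equiv (MeasurableEquiv.toLp 2 (Fin d → ℝ)) f

lemma integrable_eval_stdGaussian (P : MvPolynomial (Fin d) ℝ) :
    Integrable (fun x : Vec d => MvPolynomial.eval x.ofLp P) (stdGaussian (Vec d)) := by
  rw [integrable_stdGaussian_iff_pi]
  simp only [MvPolynomial.eval_eq']
  refine integrable_finsetSum _ fun s _ => Integrable.const_mul ?_ _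
  exact Integrable.fintype_prod (f := fun l t => t ^ s l) fun l => integrable_pow_gaussianReal _

/-- The expectation of a polynomial under the standard Gaussian. -/
noncomputable def gaussianExp : MvPolynomial (Fin d) ℝ →ₗ[ℝ] ℝ where
  toFun P := ∫ x : Vec d, MvPolynomial.eval x.ofLp P ∂(stdGaussian (Vec d))
  map_add' P Q := by
    simp only [map_add]
    exact integral_add (integrable_eval_stdGaussian P) (integrable_eval_stdGaussian Q)
  map_smul' a P := by
    simp only [MvPolynomial.smul_eval, integral_const_mul, RingHom.id_apply, smul_eq_mul]

lemma gaussianExp_apply (P : MvPolynomial (Fin d) ℝ) :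
    gaussianExp P = ∫ x : Vec d, MvPolynomial.eval x.ofLp P ∂(stdGaussian (Vec d)) := rfl

lemma gaussianExp_mono {P Q : MvPolynomial (Fin d) ℝ}
    (h : ∀ x : Fin d → ℝ, MvPolynomial.eval x P ≤ MvPolynomial.eval x Q) :
    gaussianExp P ≤ gaussianExp Q :=
  integral_mono (integrable_eval_stdGaussian P) (integrable_eval_stdGaussian Q) fun x => h x.ofLp

lemma gaussianExp_monomial (s : Fin d →₀ ℕ) (a : ℝ) :
    gaussianExp (MvPolynomial.monomial s a) = a * ∏ l, gaussianMoment (s l) := by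
  rw [gaussianExp_apply, integral_stdGaussian_eq_pi]
  simp only [MvPolynomial.eval_monomial, Finsupp.prod_fintype _ _ (fun _ => pow_zero _),
    integral_const_mul]
  rw [integral_fintype_prod_eq_prod (𝕜 := ℝ) (fun l t => t ^ s l)]
  rfl

lemma gaussianExp_C (a : ℝ) : gaussianExp (MvPolynomial.C a : MvPolynomial (Fin d) ℝ) = a := by
  simp [gaussianExp_apply]

/-- Integration by parts against the standard Gaussian. -/
lemma gaussianExp_X_mul (l : Fin d) (P : MvPolynomial (Fin d) ℝ) :
    gaussianExp (MvPolynomial.X l * P) = gaussianExp (MvPolynomial.pderiv l P) := by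
  induction P using MvPolynomial.induction_on' with
  | monomial s a =>
    rw [MvPolynomial.pderiv_monomial, mul_comm, MvPolynomial.X, MvPolynomial.monomial_mul, mul_one,
      gaussianExp_monomial, gaussianExp_monomial,
      ← Finset.mul_prod_erase _ _ (Finset.mem_univ l),
      ← Finset.mul_prod_erase _ _ (Finset.mem_univ l)]
    -- Only coordinate `l` changes, and there the moment recursion supplies the factor `s l`. If `s
    -- l = 0`, both sides vanish, so truncation does no harm.
    have h : ∀ l' ∈ Finset.univ.erase l, gaussianMoment ((s + Finsupp.single l 1 : Fin d →₀ ℕ) l') =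
        gaussianMoment ((s - Finsupp.single l 1 : Fin d →₀ ℕ) l') := by
      intro l' hl'
      simp [Finsupp.single_eq_of_ne (Finset.ne_of_mem_erase hl')]
    rw [Finset.prod_congr rfl h]
    simp only [Finsupp.add_apply, Finsupp.single_eq_same, Finsupp.tsub_apply, gaussianMoment_succ]
    ring
  | add P Q hP hQ => rw [mul_add, map_add, map_add, map_add, hP, hQ]

/-- The creation operator `X_l - ∂_l` is the adjoint of `∂_l` under the Gaussian. -/
lemma gaussianExp_mul_hermPoly_add_single (P : MvPolynomial (Fin d) ℝ) (l : Fin d)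
    (n : Fin d → ℕ) :
    gaussianExp (P * hermPoly (n + Pi.single l 1)) =
      gaussianExp (MvPolynomial.pderiv l P * hermPoly n) := by
  have h : P * hermPoly (n + Pi.single l 1) = MvPolynomial.X l * (P * hermPoly n) -
      P * MvPolynomial.pderiv l (hermPoly n) := by
    rw [hermPoly_add_single]; ring
  rw [h, map_sub, gaussianExp_X_mul, ← map_sub, Derivation.leibniz]
  congr 1
  simp only [smul_eq_mul]
  ring

end GaussianIntegrals

/-! ### Orthogonality and Hermite expansion on the line. -/

section HermiteExpansion

lemma integral_mul_realHermite_succ (q : Polynomial ℝ) (n : ℕ) :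
    ∫ t, (q * realHermite (n + 1)).eval t ∂(gaussianReal 0 1) =
      ∫ t, (Polynomial.derivative q * realHermite n).eval t ∂(gaussianReal 0 1) := by
  have h := integral_mul_eval_gaussianReal (q * realHermite n)
  have h2 : ∀ t : ℝ, (q * realHermite (n + 1)).eval t = t * (q * realHermite n).eval t -
      (q * Polynomial.derivative (realHermite n)).eval t := by
    intro t
    simp only [realHermite_succ, Polynomial.eval_mul, Polynomial.eval_sub, Polynomial.eval_X]
    ring
  have h3 : Integrable (fun t : ℝ => t * (q * realHermite n).eval t) (gaussianReal 0 1) := by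
    refine (integrable_eval_gaussianReal (Polynomial.X * (q * realHermite n))).congr
      (Filter.Eventually.of_forall fun t => ?_)
    simp
  simp_rw [h2]
  rw [integral_sub h3 (integrable_eval_gaussianReal _), h,
    ← integral_sub (integrable_eval_gaussianReal _) (integrable_eval_gaussianReal _)]
  congr 1; funext t
  simp only [Polynomial.derivative_mul, Polynomial.eval_mul, Polynomial.eval_add]
  ring

lemma integral_realHermite_mul_realHermite (m n : ℕ) :
    ∫ t, (realHermite m * realHermite n).eval t ∂(gaussianReal 0 1) =
      if m = n then (n.factorial : ℝ) else 0 := by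
  induction n generalizing m with
  | zero =>
    cases m with
    | zero => simp [realHermite_zero]
    | succ m =>
      rw [mul_comm, integral_mul_realHermite_succ]
      simp [realHermite_zero]
  | succ n ih =>
    rw [integral_mul_realHermite_succ]
    cases m with
    | zero => simp [realHermite_zero]
    | succ m =>
      rw [derivative_realHermite_succ]
      have : ∀ t : ℝ, (((m : Polynomial ℝ) + 1) * realHermite m * realHermite n).eval t =
          ((m : ℝ) + 1) * (realHermite m * realHermite n).eval t := by
        intro t; simp [mul_assoc]
      simp_rw [this]
      rw [integral_const_mul, ih]
      by_cases h : m = n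
      · subst h; simp [Nat.factorial_succ]
      · simp [h]

/-- The Hermite polynomials are monic, one in each degree, so subtracting a multiple of the top one
lowers the degree. -/
lemma exists_eq_sum_realHermite (k : ℕ) (p : Polynomial ℝ) (hp : p.natDegree ≤ k) :
    ∃ a : ℕ → ℝ, p = ∑ m ∈ Finset.range (k + 1), Polynomial.C (a m) * realHermite m := by
  induction k generalizing p with
  | zero =>
    refine ⟨fun _ => p.coeff 0, ?_⟩
    rw [Polynomial.eq_C_of_natDegree_le_zero hp]
    simp [realHermite_zero]
  | succ k ih =>
    obtain ⟨a, ha⟩ := ih (p - Polynomial.C (p.coeff (k + 1)) * realHermite (k + 1)) (by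
      rw [Polynomial.natDegree_le_iff_coeff_eq_zero]
      intro N hN
      rw [Polynomial.coeff_sub, Polynomial.coeff_C_mul]
      rcases (Nat.succ_le_of_lt hN).eq_or_lt with h | h
      · subst h
        have := (realHermite_monic (k + 1)).coeff_natDegree
        rw [natDegree_realHermite] at this
        simp [this]
      · rw [Polynomial.coeff_eq_zero_of_natDegree_lt (hp.trans_lt h),
          Polynomial.coeff_eq_zero_of_natDegree_lt (p := realHermite _)
            (by rw [natDegree_realHermite]; exact h)]
        simp)
    refine ⟨fun m => if m = k + 1 then p.coeff (k + 1) else a m, ?_⟩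
    simp only [Finset.sum_range_succ _ (k + 1), if_pos]
    have : ∑ m ∈ Finset.range (k + 1),
        Polynomial.C (if m = k + 1 then p.coeff (k + 1) else a m) * realHermite m =
        ∑ m ∈ Finset.range (k + 1), Polynomial.C (a m) * realHermite m :=
      Finset.sum_congr rfl fun m hm => by rw [if_neg (Finset.mem_range.1 hm).ne]
    rw [this, ← ha]
    ring

/-- The normalized Hermite expansion of a polynomial of mean zero and variance one. -/
lemma exists_normalized_hermite_expansion (k : ℕ) (p : Polynomial ℝ) (hp : p.natDegree ≤ k)
    (h0 : ∫ t, p.eval t ∂(gaussianReal 0 1) = 0)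
    (h1 : Var[fun t => p.eval t; gaussianReal 0 1] = 1) :
    ∃ b : Fin k → ℝ, (∀ t, p.eval t = ∑ n : Fin k, b n *
        (1 / √(((n : ℕ) + 1).factorial : ℝ) * (realHermite (n + 1)).eval t)) ∧
      ∑ n : Fin k, b n ^ 2 = 1 := by
  obtain ⟨a, ha⟩ := exists_eq_sum_realHermite k p hp
  have hinner : ∀ n ∈ Finset.range (k + 1),
      ∫ t, (p * realHermite n).eval t ∂(gaussianReal 0 1) = a n * n.factorial := by
    intro n hn
    have : ∀ t : ℝ, (p * realHermite n).eval t = ∑ m ∈ Finset.range (k + 1),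
        a m * (realHermite m * realHermite n).eval t := by
      intro t
      conv_lhs => rw [ha]
      simp [Polynomial.eval_finsetSum, Finset.sum_mul, mul_assoc]
    simp_rw [this]
    rw [integral_finsetSum _ fun m _ => (integrable_eval_gaussianReal _).const_mul _]
    simp_rw [integral_const_mul, integral_realHermite_mul_realHermite]
    rw [Finset.sum_eq_single_of_mem n hn]
    · simp
    · intro m _ hm; simp [hm]
  have ha0 : a 0 = 0 := by
    have := hinner 0 (by simp)
    simp only [realHermite_zero, mul_one, Nat.factorial_zero, Nat.cast_one] at this
    rw [← this, h0]
  have hsq : ∫ t, (p * p).eval t ∂(gaussianReal 0 1) = 1 := by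
    have hmem : MemLp (fun t => p.eval t) 2 (gaussianReal 0 1) := by
      rw [memLp_two_iff_integrable_sq (by fun_prop)]
      refine (integrable_eval_gaussianReal (p ^ 2)).congr
        (Filter.Eventually.of_forall fun t => ?_)
      simp
    rw [variance_eq_sub hmem, h0] at h1
    rw [← h1]
    simp [sq]
  have hsum : ∑ m ∈ Finset.range (k + 1), a m ^ 2 * m.factorial = 1 := by
    rw [← hsq]
    have : ∀ t : ℝ, (p * p).eval t = ∑ m ∈ Finset.range (k + 1),
        a m * (p * realHermite m).eval t := by
      intro t
      conv_lhs => rw [Polynomial.eval_mul]; arg 2; rw [ha]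
      rw [Polynomial.eval_finsetSum, Finset.mul_sum]
      refine Finset.sum_congr rfl fun m _ => ?_
      simp only [Polynomial.eval_mul, Polynomial.eval_C]; ring
    simp_rw [this]
    rw [integral_finsetSum _ fun m _ => (integrable_eval_gaussianReal _).const_mul _]
    refine Finset.sum_congr rfl fun m hm => ?_
    rw [integral_const_mul, hinner m hm]; ring
  -- The factor `√((n + 1)!)` normalizes `He_{n+1}`; the index shift drops the zero constant term.
  refine ⟨fun n => a (n + 1) * √(((n : ℕ) + 1).factorial : ℝ), fun t => ?_, ?_⟩
  · conv_lhs => rw [ha]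
    rw [Polynomial.eval_finsetSum, Finset.sum_range_succ', ha0, Finset.sum_range]
    simp only [Polynomial.eval_mul, Polynomial.eval_C, zero_mul, add_zero]
    refine Finset.sum_congr rfl fun n _ => ?_
    have : √(((n : ℕ) + 1).factorial : ℝ) ≠ 0 :=
      (Real.sqrt_pos.2 (by exact_mod_cast Nat.factorial_pos _)).ne'
    field_simp
  · rw [Finset.sum_range_succ', ha0, Finset.sum_range] at hsum
    simp only [ne_eq, OfNat.ofNat_ne_zero, not_false_eq_true, zero_pow, zero_mul, add_zero] at hsum
    rw [← hsum]
    refine Finset.sum_congr rfl fun n _ => ?_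
    rw [mul_pow, Real.sq_sqrt (by positivity)]

end HermiteExpansion

/-! ### Hermite polynomials of a linear form. -/

section HermiteContraction

variable {d : ℕ}

lemma sum_cons {M : Type*} [AddCommMonoid M] {m : ℕ} (F : (Fin (m + 1) → Fin d) → M) :
    ∑ i, F i = ∑ l, ∑ I, F (Fin.cons l I) := by
  rw [← Fintype.sum_prod_type' (f := fun l I => F (Fin.cons l I)),
    ← (Fin.consEquiv fun _ : Fin (m + 1) => Fin d).sum_comp]
  rfl

/-- The Hermite tensor contracted with the powers of a unit vector. -/
lemma aeval_realHermite_eq_sum (v : Vec d) (hv : ‖v‖ = 1) (m : ℕ) :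
    Polynomial.aeval (∑ l, MvPolynomial.C (v l) * MvPolynomial.X l : MvPolynomial (Fin d) ℝ)
      (realHermite m) =
    ∑ i : Fin m → Fin d, MvPolynomial.C (∏ c, v (i c)) * hermPoly (indexCount i) := by
  have hv2 : ∑ l, v l * v l = 1 := by
    have := EuclideanSpace.real_norm_sq_eq v
    rw [hv] at this
    simpa [sq] using this.symm
  set y : MvPolynomial (Fin d) ℝ := ∑ l, MvPolynomial.C (v l) * MvPolynomial.X l with hy
  have hdy : ∀ l, MvPolynomial.pderiv l y = MvPolynomial.C (v l) := by
    intro l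
    rw [hy, map_sum, Finset.sum_eq_single l]
    · simp [Derivation.leibniz]
    · intro l' _ h
      simp [Derivation.leibniz, MvPolynomial.pderiv_X_of_ne h]
    · simp
  induction m with
  | zero =>
    have : ∀ i : Fin 0 → Fin d, indexCount i = 0 := fun i => by
      funext l; simp [indexCount, countOn]
    simp [realHermite_zero, this, hermPoly_zero]
  | succ m ih =>
    -- Summed over `l`, the operators `v_l (X_l - ∂_l)` send `f(y)` to `y f(y) - f'(y)`, because
    -- `∂_l y = v_l` and `∑ v_l² = 1`. This is the one-variable Hermite recursion.
    have h1 : ∀ l, MvPolynomial.C (v l) * (MvPolynomial.X l * Polynomial.aeval y (realHermite m) -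
        MvPolynomial.pderiv l (Polynomial.aeval y (realHermite m))) =
        ∑ I : Fin m → Fin d, MvPolynomial.C (∏ c, v ((Fin.cons l I : Fin (m + 1) → Fin d) c)) *
          hermPoly (indexCount (Fin.cons l I : Fin (m + 1) → Fin d)) := by
      intro l
      rw [ih, map_sum, Finset.mul_sum, ← Finset.sum_sub_distrib, Finset.mul_sum]
      refine Finset.sum_congr rfl fun I _ => ?_
      rw [indexCount_cons, hermPoly_add_single, Fin.prod_univ_succ, Derivation.leibniz]
      simp only [Fin.cons_zero, Fin.cons_succ, MvPolynomial.pderiv_C, map_mul, smul_eq_mul]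
      ring
    rw [sum_cons, ← Finset.sum_congr rfl fun l _ => h1 l]
    simp only [Derivation.map_aeval, hdy, smul_eq_mul, mul_sub, Finset.sum_sub_distrib]
    rw [realHermite_succ, map_sub, map_mul, Polynomial.aeval_X]
    congr 1
    · rw [hy, Finset.sum_mul]
      refine Finset.sum_congr rfl fun l _ => ?_
      ring
    · have : ∀ l, MvPolynomial.C (v l) * (Polynomial.aeval y
          (Polynomial.derivative (realHermite m)) * MvPolynomial.C (v l)) =
          MvPolynomial.C (v l * v l) *
            Polynomial.aeval y (Polynomial.derivative (realHermite m)) := by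
        intro l; rw [MvPolynomial.C_mul]; ring
      simp_rw [this]
      rw [← Finset.sum_mul, ← map_sum, hv2, map_one, one_mul]

lemma eval_realHermite_inner (v : Vec d) (hv : ‖v‖ = 1) (m : ℕ) (x : Vec d) :
    1 / √(m.factorial : ℝ) * (realHermite m).eval (inner ℝ v x) =
      ∑ i : Fin m → Fin d, (∏ c, v (i c)) * hermiteTensor m x i := by
  have h := congrArg (MvPolynomial.eval x.ofLp) (aeval_realHermite_eq_sum v hv m)
  have h2 : inner ℝ v x = MvPolynomial.eval x.ofLp
      (∑ l, MvPolynomial.C (v l) * MvPolynomial.X l : MvPolynomial (Fin d) ℝ) := by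
    simp [PiLp.inner_apply, mul_comm]
  have h3 : MvPolynomial.eval x.ofLp (Polynomial.aeval
      (∑ l, MvPolynomial.C (v l) * MvPolynomial.X l : MvPolynomial (Fin d) ℝ) (realHermite m)) =
      (realHermite m).eval (inner ℝ v x) := by
    rw [h2, ← Polynomial.coe_aeval_eq_eval, ← MvPolynomial.coe_aeval_eq_eval]
    exact (Polynomial.aeval_algHom_apply (MvPolynomial.aeval x.ofLp) _ _).symm
  rw [← h3, h, map_sum, Finset.mul_sum]
  refine Finset.sum_congr rfl fun i _ => ?_
  rw [hermiteTensor_eq, map_mul, MvPolynomial.eval_C]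
  ring

end HermiteContraction

/-! ### Calculus of contractions with Hermite tensors. -/

section Contraction

variable {d m : ℕ}

/-- A tensor is symmetric if its entries depend only on the number of occurrences of each index. -/
def Tensor.IsSymm (T : Tensor d m) : Prop :=
  ∀ i i', indexCount i = indexCount i' → T i = T i'

/-- The tensor obtained by fixing the first index. -/
def Tensor.slice (T : Tensor d (m + 1)) (l : Fin d) : Tensor d m := fun I => T (Fin.cons l I)

lemma Tensor.IsSymm.slice {T : Tensor d (m + 1)} (hT : T.IsSymm) (l : Fin d) :
    (T.slice l).IsSymm := fun I I' h => hT _ _ (by rw [indexCount_cons, indexCount_cons, h])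

/-- The contraction of a tensor with the (unnormalized) Hermite tensor. -/
noncomputable def Tensor.hermContract (T : Tensor d m) : MvPolynomial (Fin d) ℝ :=
  ∑ i, MvPolynomial.C (T i) * hermPoly (indexCount i)

lemma sum_insertNth {M : Type*} [AddCommMonoid M] (c : Fin (m + 1))
    (F : (Fin (m + 1) → Fin d) → M) :
    ∑ i, F i = ∑ l, ∑ I : Fin m → Fin d, F (c.insertNth l I) := by
  rw [← Fintype.sum_prod_type' (f := fun l I => F (c.insertNth l I)),
    ← (Fin.insertNthEquiv (fun _ : Fin (m + 1) => Fin d) c).sum_comp]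
  rfl

/-- Differentiation removes one of the `m + 1` positions carrying the index `l`. By symmetry every
position gives the same contribution as the first. -/
lemma pderiv_hermContract {T : Tensor d (m + 1)} (hT : T.IsSymm) (l : Fin d) :
    MvPolynomial.pderiv l T.hermContract =
      MvPolynomial.C ((m : ℝ) + 1) * (T.slice l).hermContract := by
  have h1 : ∀ i : Fin (m + 1) → Fin d,
      MvPolynomial.pderiv l (MvPolynomial.C (T i) * hermPoly (indexCount i)) =
      ∑ c, if i c = l then MvPolynomial.C (T i) *
        hermPoly (indexCount i - Pi.single l 1) else 0 := by
    intro i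
    rw [MvPolynomial.pderiv_C_mul, pderiv_hermPoly, ← Finset.sum_filter, Finset.sum_const,
      nsmul_eq_mul]
    change _ = (indexCount i l : MvPolynomial (Fin d) ℝ) * _
    ring
  have h2 : ∀ c : Fin (m + 1), (∑ i : Fin (m + 1) → Fin d, if i c = l then MvPolynomial.C (T i) *
      hermPoly (indexCount i - Pi.single l 1) else 0) = (T.slice l).hermContract := by
    intro c
    rw [sum_insertNth c, Finset.sum_eq_single l]
    · refine Finset.sum_congr rfl fun I _ => ?_
      rw [if_pos (Fin.insertNth_apply_same _ _ _), indexCount_insertNth, add_tsub_cancel_right,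
        Tensor.slice, hT (c.insertNth l I) (Fin.cons l I)
          (by rw [indexCount_insertNth, indexCount_cons])]
    · intro l' _ hl'
      refine Finset.sum_eq_zero fun I _ => ?_
      rw [if_neg (by rwa [Fin.insertNth_apply_same])]
    · simp
  rw [Tensor.hermContract, map_sum, Finset.sum_congr rfl fun i _ => h1 i, Finset.sum_comm,
    Finset.sum_congr rfl fun c _ => h2 c]
  simp

lemma gaussianExp_mul_hermContract (P : MvPolynomial (Fin d) ℝ) (T : Tensor d (m + 1)) :
    gaussianExp (P * T.hermContract) =
      ∑ l, gaussianExp (MvPolynomial.pderiv l P * (T.slice l).hermContract) := by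
  simp only [Tensor.hermContract, Finset.mul_sum, map_sum]
  rw [sum_cons]
  refine Finset.sum_congr rfl fun l _ => Finset.sum_congr rfl fun I _ => ?_
  rw [mul_left_comm, mul_left_comm (MvPolynomial.pderiv l P), ← MvPolynomial.smul_eq_C_mul,
    ← MvPolynomial.smul_eq_C_mul, map_smul, map_smul, indexCount_cons, gaussianExp_mul_hermPoly_add_single, Tensor.slice]

end Contraction

/-! ### Even moments of Gaussian chaos. -/

section Hypercontractivity

lemma young_pow (q : ℕ) {a b : ℝ} (ha : 0 ≤ a) (hb : 0 ≤ b) :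
    ((q : ℝ) + 1) * (a ^ q * b) ≤ q * a ^ (q + 1) + b ^ (q + 1) := by
  induction q with
  | zero => simp
  | succ q ih =>
    have h1 := mul_le_mul_of_nonneg_left ih hb
    -- Adding this square to `b` times the induction hypothesis gives the next case exactly.
    have h2 : 0 ≤ ((q : ℝ) + 1) * a ^ q * (a - b) ^ 2 := by positivity
    push_cast
    have e1 : a ^ (q + 1) = a ^ q * a := pow_succ _ _
    have e2 : a ^ (q + 1 + 1) = a ^ q * a * a := by rw [pow_succ, pow_succ]
    have e3 : b ^ (q + 1 + 1) = b * b ^ (q + 1) := pow_succ' _ _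
    rw [e1] at h1
    rw [e1, e2, e3]
    nlinarith

variable {d : ℕ}

/-- The sum of the squares of the contractions of a family of tensors. -/
noncomputable def sqContract {A : Type} [Fintype A] {m : ℕ} (T : A → Tensor d m) :
    MvPolynomial (Fin d) ℝ := ∑ a, (T a).hermContract ^ 2

/-- The slices of a family of tensors. -/
def sliceFamily {A : Type} {m : ℕ} (T : A → Tensor d (m + 1)) : A × Fin d → Tensor d m :=
  fun a => (T a.1).slice a.2

lemma eval_sqContract_nonneg {A : Type} [Fintype A] {m : ℕ} (T : A → Tensor d m)
    (x : Fin d → ℝ) : 0 ≤ MvPolynomial.eval x (sqContract T) := by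
  simp only [sqContract, map_sum, map_pow]
  exact Finset.sum_nonneg fun a _ => sq_nonneg _

/-- The expectation of `(∑ G_a²)^(q + 1)`, after integrating by parts once. -/
lemma gaussianExp_sqContract_pow {A : Type} [Fintype A] {m : ℕ} (T : A → Tensor d (m + 1))
    (hT : ∀ a, (T a).IsSymm) (q : ℕ) :
    gaussianExp (sqContract T ^ (q + 1)) =
      gaussianExp (MvPolynomial.C ((m : ℝ) + 1) *
        (sqContract T ^ q * sqContract (sliceFamily T) + MvPolynomial.C (2 * (q : ℝ)) *
          sqContract T ^ (q - 1) *
          ∑ l, (∑ b, (T b).hermContract * ((T b).slice l).hermContract) ^ 2)) := by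
  have h1 : sqContract T ^ (q + 1) =
      ∑ a, (sqContract T ^ q * (T a).hermContract) * (T a).hermContract := by
    rw [pow_succ]
    conv_lhs => arg 2; rw [sqContract]
    rw [Finset.mul_sum]
    exact Finset.sum_congr rfl fun a _ => by ring
  have h2 : ∀ l, MvPolynomial.pderiv l (sqContract T) = MvPolynomial.C ((m : ℝ) + 1) * 2 *
      ∑ b, (T b).hermContract * ((T b).slice l).hermContract := by
    intro l
    rw [sqContract, map_sum, Finset.mul_sum]
    refine Finset.sum_congr rfl fun b _ => ?_
    rw [Derivation.leibniz_pow, pderiv_hermContract (hT b)]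
    simp only [Nat.add_one_sub_one, pow_one, smul_eq_mul, nsmul_eq_mul, Nat.cast_ofNat]
    ring
  rw [h1, map_sum]
  simp only [gaussianExp_mul_hermContract]
  simp only [← map_sum]
  congr 1
  rw [Finset.sum_comm]
  have h3 : ∀ l, ∑ a, MvPolynomial.pderiv l (sqContract T ^ q * (T a).hermContract) *
      ((T a).slice l).hermContract = MvPolynomial.C ((m : ℝ) + 1) *
        (sqContract T ^ q * (∑ a, ((T a).slice l).hermContract ^ 2) +
          MvPolynomial.C (2 * (q : ℝ)) * sqContract T ^ (q - 1) *
          (∑ b, (T b).hermContract * ((T b).slice l).hermContract) ^ 2) := by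
    intro l
    have : ∀ a, MvPolynomial.pderiv l (sqContract T ^ q * (T a).hermContract) *
        ((T a).slice l).hermContract = MvPolynomial.C ((m : ℝ) + 1) *
        (sqContract T ^ q * ((T a).slice l).hermContract ^ 2 +
          MvPolynomial.C (2 * (q : ℝ)) * sqContract T ^ (q - 1) *
          (∑ b, (T b).hermContract * ((T b).slice l).hermContract) *
            ((T a).hermContract * ((T a).slice l).hermContract)) := by
      intro a
      rw [Derivation.leibniz, Derivation.leibniz_pow, pderiv_hermContract (hT a), h2]
      simp only [smul_eq_mul, nsmul_eq_mul, map_mul, map_natCast, map_ofNat]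
      ring
    rw [Finset.sum_congr rfl fun a _ => this a, ← Finset.mul_sum, Finset.sum_add_distrib,
      ← Finset.mul_sum, ← Finset.mul_sum]
    ring
  rw [Finset.sum_congr rfl fun l _ => h3 l, ← Finset.mul_sum, Finset.sum_add_distrib,
    ← Finset.mul_sum, ← Finset.mul_sum, Finset.sum_comm,
    show sqContract (sliceFamily T) = ∑ a, ∑ l, ((T a).slice l).hermContract ^ 2 from
      Fintype.sum_prod_type _]

/-- One differentiation trades order `m + 1` for order `m`. After integration by parts,
Cauchy–Schwarz bounds the cross terms by `S S'`, so the integrand is at most `K S^q S'`; Young's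
inequality then splits off a part of `E[S^(q+1)]` that the left side absorbs. -/
lemma gaussianExp_sqContract_pow_le {A : Type} [Fintype A] {m : ℕ} (T : A → Tensor d (m + 1))
    (hT : ∀ a, (T a).IsSymm) (q : ℕ) :
    gaussianExp (sqContract T ^ (q + 1)) ≤
      ((2 * (q : ℝ) + 1) * ((m : ℝ) + 1)) ^ (q + 1) *
        gaussianExp (sqContract (sliceFamily T) ^ (q + 1)) := by
  set K : ℝ := (2 * (q : ℝ) + 1) * ((m : ℝ) + 1) with hK
  set S := sqContract T
  set S' := sqContract (sliceFamily T)
  have key : ((q : ℝ) + 1) * gaussianExp (S ^ (q + 1)) ≤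
      q * gaussianExp (S ^ (q + 1)) + K ^ (q + 1) * gaussianExp (S' ^ (q + 1)) := by
    conv_lhs => rw [gaussianExp_sqContract_pow T hT q]
    rw [← smul_eq_mul, ← smul_eq_mul (q : ℝ), ← smul_eq_mul (K ^ (q + 1)), ← map_smul, ← map_smul,
      ← map_smul, ← map_add]
    refine gaussianExp_mono fun x => ?_
    have hS : 0 ≤ MvPolynomial.eval x S := eval_sqContract_nonneg T x
    have hS' : 0 ≤ MvPolynomial.eval x S' := eval_sqContract_nonneg _ x
    have hcs : MvPolynomial.eval x
        (∑ l, (∑ b, (T b).hermContract * ((T b).slice l).hermContract) ^ 2) ≤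
        MvPolynomial.eval x S * MvPolynomial.eval x S' := by
      have e : MvPolynomial.eval x S' =
          ∑ l, ∑ b, (MvPolynomial.eval x ((T b).slice l).hermContract) ^ 2 := by
        simp only [S', sqContract, map_sum, map_pow]
        rw [Fintype.sum_prod_type, Finset.sum_comm]
        rfl
      rw [e, Finset.mul_sum, map_sum]
      refine Finset.sum_le_sum fun l _ => ?_
      simp only [S, sqContract, map_sum, map_pow, map_mul]
      exact Finset.sum_mul_sq_le_sq_mul_sq _ _ _
    have hy := young_pow q hS (mul_nonneg (by positivity : 0 ≤ K) hS')
    simp only [MvPolynomial.smul_eval, map_add, map_mul, map_pow, MvPolynomial.eval_C] at hcs hy ⊢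
    set Z := MvPolynomial.eval x
        (∑ l, (∑ b, (T b).hermContract * ((T b).slice l).hermContract) ^ 2)
    set s := MvPolynomial.eval x S
    set s' := MvPolynomial.eval x S'
    -- The factor `q` is kept because `q - 1` truncates at `q = 0`, where the term vanishes.
    have hq : (q : ℝ) * (s ^ (q - 1) * Z) ≤ q * (s ^ q * s') := by
      rcases q with _ | q
      · simp
      · have : s ^ q * Z ≤ s ^ q * (s * s') := mul_le_mul_of_nonneg_left hcs (by positivity)
        rw [Nat.add_sub_cancel, pow_succ s q, mul_assoc (s ^ q)]
        exact mul_le_mul_of_nonneg_left this (by positivity)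
    rw [← mul_pow]
    refine le_trans ?_ hy
    refine mul_le_mul_of_nonneg_left ?_ (by positivity)
    have : ((m : ℝ) + 1) * (s ^ q * s' + 2 * ↑q * s ^ (q - 1) * Z) ≤
        ((m : ℝ) + 1) * (s ^ q * s' + 2 * (q * (s ^ q * s'))) := by
      refine mul_le_mul_of_nonneg_left ?_ (by positivity)
      linarith
    refine this.trans (le_of_eq ?_)
    rw [hK]; ring
  linarith

/-- Hypercontractivity for the even moments of Gaussian chaos of a fixed order. -/
theorem gaussianExp_sqContract_le (q m : ℕ) {A : Type} [Fintype A] (T : A → Tensor d m)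
    (hT : ∀ a, (T a).IsSymm) :
    gaussianExp (sqContract T ^ (q + 1)) ≤
      ((2 * (q : ℝ) + 1) ^ m * m.factorial * ∑ a, ∑ i, T a i ^ 2) ^ (q + 1) := by
  induction m generalizing A with
  | zero =>
    have h : ∀ i : Fin 0 → Fin d, indexCount i = 0 := fun i => by
      funext l; simp [indexCount, countOn]
    have : sqContract T = MvPolynomial.C (∑ a, ∑ i, T a i ^ 2) := by
      simp [sqContract, Tensor.hermContract, h, hermPoly_zero]
    rw [this, ← map_pow, gaussianExp_C]
    simp
  | succ m ih =>
    refine (gaussianExp_sqContract_pow_le T hT q).trans ?_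
    -- Slicing enlarges the family but keeps its total squared norm, which is why the induction runs
    -- over families rather than single tensors.
    have h := ih (sliceFamily T) fun a => (hT a.1).slice a.2
    have e : ∑ a, ∑ I, sliceFamily T a I ^ 2 = ∑ a, ∑ i, T a i ^ 2 := by
      rw [Fintype.sum_prod_type]
      refine Finset.sum_congr rfl fun a _ => ?_
      rw [sum_cons]
      rfl
    rw [e] at h
    refine (mul_le_mul_of_nonneg_left h (by positivity)).trans (le_of_eq ?_)
    rw [← mul_pow, Nat.factorial_succ]
    push_cast
    ring

end Hypercontractivity

/-! ### The level inequality for Chow parameters. -/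

section ChowParameters

variable {d : ℕ}

lemma measurable_negInd : Measurable negInd :=
  Measurable.ite (measurableSet_singleton _) measurable_const measurable_const

lemma negInd_nonneg (y : ℝ) : 0 ≤ negInd y := by unfold negInd; split_ifs <;> norm_num

lemma negInd_le_one (y : ℝ) : negInd y ≤ 1 := by unfold negInd; split_ifs <;> norm_num

variable {D : Measure (Vec d × ℝ)}

lemma integrable_eval_fst (hD : D.map Prod.fst = stdGaussian (Vec d))
    (P : MvPolynomial (Fin d) ℝ) :
    Integrable (fun z : Vec d × ℝ => MvPolynomial.eval z.1.ofLp P) D := by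
  have h := integrable_eval_stdGaussian P
  rw [← hD] at h
  exact h.comp_measurable measurable_fst

lemma integral_eval_fst (hD : D.map Prod.fst = stdGaussian (Vec d))
    (P : MvPolynomial (Fin d) ℝ) :
    ∫ z, MvPolynomial.eval z.1.ofLp P ∂D = gaussianExp P := by
  have h := integrable_eval_stdGaussian P
  rw [gaussianExp_apply, ← hD] at *
  exact (integral_map measurable_fst.aemeasurable h.1).symm

lemma integrable_negInd_mul (hD : D.map Prod.fst = stdGaussian (Vec d))
    (P : MvPolynomial (Fin d) ℝ) :
    Integrable (fun z : Vec d × ℝ => negInd z.2 * MvPolynomial.eval z.1.ofLp P) D := by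
  refine (integrable_eval_fst hD P).bdd_mul (c := 1)
    (measurable_negInd.comp measurable_snd).aestronglyMeasurable
    (Filter.Eventually.of_forall fun z => ?_)
  rw [Real.norm_of_nonneg (negInd_nonneg _)]
  exact negInd_le_one _

lemma integral_negInd : ∫ z, negInd z.2 ∂D = D.real {z | z.2 = -1} := by
  have hm : MeasurableSet {z : Vec d × ℝ | z.2 = -1} :=
    measurable_snd (measurableSet_singleton (-1 : ℝ))
  rw [← integral_indicator_one hm]
  rfl

/-- A moment bound controls the correlation with a small event. -/
lemma integral_negInd_mul_le (hD : D.map Prod.fst = stdGaussian (Vec d))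
    (P : MvPolynomial (Fin d) ℝ) (q : ℕ) {N : ℝ} (hN : 0 < N)
    (hP : gaussianExp ((P ^ 2) ^ (q + 1)) ≤ (N ^ 2) ^ (q + 1))
    (hγ : Real.exp (-(3 * ((q : ℝ) + 1))) ≤ D.real {z | z.2 = -1}) :
    ∫ z, negInd z.2 * MvPolynomial.eval z.1.ofLp P ∂D ≤
      N * Real.exp (3 / 2) * D.real {z | z.2 = -1} := by
  set γ := D.real {z : Vec d × ℝ | z.2 = -1} with hγdef
  -- This threshold makes `N^(2q+2) = s^(2q+2) e^(-3(q+1))`, which is at most `s^(2q+2) γ`; so the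
  -- moment term matches the indicator term below.
  set s := N * Real.exp (3 / 2) with hs
  have hs0 : 0 < s := by positivity
  -- Young's inequality at exponent `2q + 2` on the event `y = -1`; off the event the right side is
  -- nonnegative.
  have hpt : ∀ z : Vec d × ℝ,
      (2 * (q : ℝ) + 2) * s ^ (2 * q + 1) * (negInd z.2 * MvPolynomial.eval z.1.ofLp P) ≤
      (2 * (q : ℝ) + 1) * s ^ (2 * q + 2) * negInd z.2 +
        MvPolynomial.eval z.1.ofLp ((P ^ 2) ^ (q + 1)) := by
    intro z
    set g := MvPolynomial.eval z.1.ofLp P with hg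
    have hy := young_pow (2 * q + 1) hs0.le (abs_nonneg g)
    have he : |g| ^ (2 * q + 1 + 1) = (g ^ 2) ^ (q + 1) := by
      rw [← sq_abs g, ← pow_mul]; ring_nf
    rw [he] at hy
    push_cast at hy
    simp only [map_pow, ← hg]
    unfold negInd
    split_ifs
    · have h3 : s ^ (2 * q + 1) * g ≤ s ^ (2 * q + 1) * |g| :=
        mul_le_mul_of_nonneg_left (le_abs_self g) (by positivity)
      have h4 := mul_le_mul_of_nonneg_left h3 (by positivity : 0 ≤ 2 * (q : ℝ) + 2)
      rw [mul_one, one_mul]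
      linarith
    · simp only [zero_mul, mul_zero, zero_add]
      positivity
  have hI := integral_mono ((integrable_negInd_mul hD P).const_mul _)
    ((((integrable_negInd_mul hD 1).congr (Filter.Eventually.of_forall fun z => by
      simp : _ =ᵐ[D] fun z => negInd z.2)).const_mul _).add
        (integrable_eval_fst hD ((P ^ 2) ^ (q + 1)))) hpt
  rw [integral_const_mul, integral_add' (((integrable_negInd_mul hD 1).congr
    (Filter.Eventually.of_forall fun z => by simp : _ =ᵐ[D] fun z => negInd z.2)).const_mul _)
    (integrable_eval_fst hD _), integral_const_mul, integral_eval_fst hD, integral_negInd,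
    ← hγdef] at hI
  have hN2 : (N ^ 2) ^ (q + 1) ≤ s ^ (2 * q + 2) * γ := by
    have e : s ^ (2 * q + 2) * Real.exp (-(3 * ((q : ℝ) + 1))) = (N ^ 2) ^ (q + 1) := by
      rw [hs, mul_pow, ← Real.exp_nat_mul, mul_assoc, ← Real.exp_add, ← pow_mul]
      have : ((2 * q + 2 : ℕ) : ℝ) * (3 / 2) + -(3 * ((q : ℝ) + 1)) = 0 := by push_cast; ring
      rw [this, Real.exp_zero, mul_one]; ring_nf
    rw [← e]
    exact mul_le_mul_of_nonneg_left hγ (by positivity)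
  have hfin : ((2 * (q : ℝ) + 2) * s ^ (2 * q + 1)) *
      ∫ z, negInd z.2 * MvPolynomial.eval z.1.ofLp P ∂D ≤
      ((2 * (q : ℝ) + 2) * s ^ (2 * q + 1)) * (s * γ) := by
    refine (hI.trans (add_le_add_right (hP.trans hN2) _)).trans (le_of_eq ?_)
    rw [pow_succ s (2 * q + 1)]
    ring
  exact le_of_mul_le_mul_left hfin (by positivity)

lemma chowTensor_eq (m : ℕ) (i : Fin m → Fin d) :
    chowTensor D m i = 1 / √(m.factorial : ℝ) *
      ∫ z, negInd z.2 * MvPolynomial.eval z.1.ofLp (hermPoly (indexCount i)) ∂D := by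
  rw [chowTensor, ← integral_const_mul]
  congr 1; funext z
  rw [hermiteTensor_eq]; ring

lemma chowTensor_isSymm (m : ℕ) : (chowTensor D m).IsSymm := fun i i' h => by
  rw [chowTensor_eq, chowTensor_eq, h]

lemma Tensor.frobNorm_sq {m : ℕ} (T : Tensor d m) : T.frobNorm ^ 2 = ∑ i, T i ^ 2 :=
  Real.sq_sqrt (Finset.sum_nonneg fun _ _ => sq_nonneg _)

lemma Tensor.frobNorm_nonneg {m : ℕ} (T : Tensor d m) : 0 ≤ T.frobNorm := Real.sqrt_nonneg _

/-- The level-`m` inequality: the Chow parameters of a rare event are small. -/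
theorem frobNorm_chowTensor_sq_le (hD : D.map Prod.fst = stdGaussian (Vec d)) (m : ℕ) {L : ℝ}
    (hγ : 0 < D.real {z | z.2 = -1})
    (hL : L = max 1 (Real.log (1 / D.real {z | z.2 = -1}))) :
    (chowTensor D m).frobNorm ^ 2 ≤ Real.exp 3 * D.real {z | z.2 = -1} ^ 2 * L ^ m := by
  set γ := D.real {z : Vec d × ℝ | z.2 = -1} with hγdef
  set T := chowTensor D m with hT
  have hL1 : 1 ≤ L := hL ▸ le_max_left _ _
  have hLlog : Real.log (1 / γ) ≤ L := hL ▸ le_max_right _ _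
  rcases T.frobNorm_nonneg.eq_or_lt with h0 | h0
  · rw [← h0, zero_pow two_ne_zero]
    positivity
  -- The largest `q` with `2q + 1 ≤ L`, so the hypercontractive constant is at most `L^m`.
  -- Maximality gives `log (1/γ) ≤ L < 2q + 3 ≤ 3(q + 1)`, the condition relating `γ` to the moment.
  set q := ⌊(L - 1) / 2⌋₊ with hq
  have hq1 : 2 * (q : ℝ) + 1 ≤ L := by
    have := Nat.floor_le (by linarith : 0 ≤ (L - 1) / 2)
    linarith
  have hq2 : L < 2 * (q : ℝ) + 3 := by
    have := Nat.lt_floor_add_one ((L - 1) / 2)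
    linarith
  have hexp : Real.exp (-(3 * ((q : ℝ) + 1))) ≤ γ := by
    rw [← Real.le_log_iff_exp_le hγ]
    rw [one_div, Real.log_inv] at hLlog
    have : (0 : ℝ) ≤ q := Nat.cast_nonneg _
    linarith
  set N := √((2 * (q : ℝ) + 1) ^ m * m.factorial) * T.frobNorm with hN
  have hN0 : 0 < N := by positivity
  have hNsq : N ^ 2 = (2 * (q : ℝ) + 1) ^ m * m.factorial * ∑ i, T i ^ 2 := by
    rw [hN, mul_pow, Real.sq_sqrt (by positivity), T.frobNorm_sq]
  have hmom : gaussianExp ((T.hermContract ^ 2) ^ (q + 1)) ≤ (N ^ 2) ^ (q + 1) := by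
    have := gaussianExp_sqContract_le q m (fun _ : Unit => T) fun _ => chowTensor_isSymm m
    rw [hNsq]
    simpa [sqContract] using this
  have hmain := integral_negInd_mul_le hD T.hermContract q hN0 hmom hexp
  rw [← hγdef] at hmain
  -- The tensor is tested against itself. The bound on the right is linear in `‖T‖`, so one factor
  -- cancels.
  have hsq : T.frobNorm ^ 2 = 1 / √(m.factorial : ℝ) *
      ∫ z, negInd z.2 * MvPolynomial.eval z.1.ofLp T.hermContract ∂D := by
    rw [T.frobNorm_sq]
    have : ∀ z : Vec d × ℝ, negInd z.2 * MvPolynomial.eval z.1.ofLp T.hermContract =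
        ∑ i, T i * (negInd z.2 * MvPolynomial.eval z.1.ofLp (hermPoly (indexCount i))) := by
      intro z
      simp only [Tensor.hermContract, map_sum, map_mul, MvPolynomial.eval_C, Finset.mul_sum]
      exact Finset.sum_congr rfl fun i _ => by ring
    simp_rw [this]
    rw [integral_finsetSum _ fun i _ => (integrable_negInd_mul hD _).const_mul _, Finset.mul_sum]
    refine Finset.sum_congr rfl fun i _ => ?_
    rw [integral_const_mul, sq]
    conv_lhs => arg 2; rw [hT, chowTensor_eq]
    ring
  have hf : 0 < √(m.factorial : ℝ) := Real.sqrt_pos.2 (by exact_mod_cast m.factorial_pos)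
  have hlin : T.frobNorm ≤ √((2 * (q : ℝ) + 1) ^ m) * Real.exp (3 / 2) * γ := by
    have h1 : T.frobNorm * T.frobNorm ≤
        (√((2 * (q : ℝ) + 1) ^ m) * Real.exp (3 / 2) * γ) * T.frobNorm := by
      rw [← sq, hsq]
      refine (mul_le_mul_of_nonneg_left hmain (by positivity)).trans (le_of_eq ?_)
      rw [hN, Real.sqrt_mul (by positivity)]
      field_simp
    exact le_of_mul_le_mul_right h1 h0
  calc T.frobNorm ^ 2 ≤ (√((2 * (q : ℝ) + 1) ^ m) * Real.exp (3 / 2) * γ) ^ 2 :=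
        pow_le_pow_left₀ h0.le hlin 2
    _ = Real.exp 3 * γ ^ 2 * (2 * (q : ℝ) + 1) ^ m := by
        rw [mul_pow, mul_pow, Real.sq_sqrt (by positivity), ← Real.exp_nat_mul]
        norm_num
        ring
    _ ≤ _ := by
        refine mul_le_mul_of_nonneg_left ?_ (by positivity)
        exact pow_le_pow_left₀ (by positivity) hq1 m

end ChowParameters

/-! ### Singular vectors through the eigenbasis of `A Aᵀ`. -/

section SingularVectors

variable {d : ℕ} {ι : Type} [Fintype ι] [DecidableEq ι] (A : Matrix (Fin d) ι ℝ)

lemma inner_toEuclideanLin_transpose (u : Vec d) (w : EuclideanSpace ℝ ι) :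
    inner ℝ (A.toEuclideanLin w) u = inner ℝ w (A.transpose.toEuclideanLin u) := by
  rw [← Matrix.conjTranspose_eq_transpose_of_trivial,
    Matrix.toEuclideanLin_conjTranspose_eq_adjoint, LinearMap.adjoint_inner_right]

/-- The operator `A Aᵀ`. -/
noncomputable def gramOp : Vec d →ₗ[ℝ] Vec d :=
  A.toEuclideanLin ∘ₗ A.transpose.toEuclideanLin

lemma inner_gramOp (u u' : Vec d) : inner ℝ (gramOp A u) u' =
    inner ℝ (A.transpose.toEuclideanLin u) (A.transpose.toEuclideanLin u') :=
  inner_toEuclideanLin_transpose A u' _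

lemma gramOp_isSymmetric : (gramOp A).IsSymmetric := fun u u' => by
  rw [inner_gramOp, real_inner_comm, ← inner_gramOp, real_inner_comm]

/-- An orthonormal basis of eigenvectors of `A Aᵀ`. -/
noncomputable def gramBasis : OrthonormalBasis (Fin d) ℝ (Vec d) :=
  (gramOp_isSymmetric A).eigenvectorBasis finrank_euclideanSpace_fin

lemma gramOp_gramBasis (j : Fin d) : gramOp A (gramBasis A j) =
    (‖A.transpose.toEuclideanLin (gramBasis A j)‖ ^ 2) • gramBasis A j := by
  have h := (gramOp_isSymmetric A).apply_eigenvectorBasis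
    (finrank_euclideanSpace_fin (𝕜 := ℝ) (n := d)) j
  change gramOp A (gramBasis A j) = _ • gramBasis A j at h
  have h2 := inner_gramOp A (gramBasis A j) (gramBasis A j)
  rw [h, real_inner_smul_left, real_inner_self_eq_norm_sq, (gramBasis A).norm_eq_one,
    real_inner_self_eq_norm_sq] at h2
  rw [h, ← h2]
  simp

lemma gramBasis_mem_topLeftSingularSpan {θ : ℝ} (hθ : 0 ≤ θ) (j : Fin d)
    (hj : θ < ‖A.transpose.toEuclideanLin (gramBasis A j)‖) :
    gramBasis A j ∈ topLeftSingularSpan A θ := by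
  set σ := ‖A.transpose.toEuclideanLin (gramBasis A j)‖ with hσ
  have hσ0 : 0 < σ := hθ.trans_lt hj
  refine Submodule.subset_span ⟨σ, hj, hσ0.le, (gramBasis A).norm_eq_one j,
    σ⁻¹ • A.transpose.toEuclideanLin (gramBasis A j), ?_, ?_, ?_⟩
  · rw [norm_smul, ← hσ, norm_inv, Real.norm_of_nonneg hσ0.le, inv_mul_cancel₀ hσ0.ne']
  · rw [map_smul]
    change σ⁻¹ • gramOp A (gramBasis A j) = _
    rw [gramOp_gramBasis, ← hσ, smul_smul]
    congr 1
    field_simp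
  · rw [smul_smul, mul_inv_cancel₀ hσ0.ne', one_smul]

lemma norm_transpose_sq_eq_sum (u : Vec d) : ‖A.transpose.toEuclideanLin u‖ ^ 2 =
    ∑ j, ‖A.transpose.toEuclideanLin (gramBasis A j)‖ ^ 2 * inner ℝ (gramBasis A j) u ^ 2 := by
  rw [← real_inner_self_eq_norm_sq, ← inner_gramOp, ← (gramBasis A).sum_inner_mul_inner]
  refine Finset.sum_congr rfl fun j _ => ?_
  rw [gramOp_isSymmetric A u, gramOp_gramBasis, real_inner_smul_right,
    real_inner_comm (gramBasis A j) u]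
  ring

/-- Eigenvectors with singular value above `θ` lie in the span, so `u` has no component along them;
the other components are stretched by at most `θ`. -/
lemma norm_transpose_le_of_mem_orthogonal {θ : ℝ} (hθ : 0 ≤ θ) {u : Vec d}
    (hu : u ∈ (topLeftSingularSpan A θ)ᗮ) :
    ‖A.transpose.toEuclideanLin u‖ ≤ θ * ‖u‖ := by
  refine le_of_sq_le_sq ?_ (by positivity)
  rw [norm_transpose_sq_eq_sum, mul_pow, ← (gramBasis A).sum_sq_norm_inner_right u,
    Finset.mul_sum]
  refine Finset.sum_le_sum fun j _ => ?_
  rw [Real.norm_eq_abs, sq_abs]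
  rcases lt_or_ge θ ‖A.transpose.toEuclideanLin (gramBasis A j)‖ with h | h
  · have := (Submodule.mem_orthogonal _ _).1 hu _ (gramBasis_mem_topLeftSingularSpan A hθ j h)
    rw [this]; simp
  · gcongr

/-- Parseval's identity in the eigenbasis, applied to each column of `A`. -/
lemma sum_norm_transpose_gramBasis_sq :
    ∑ j, ‖A.transpose.toEuclideanLin (gramBasis A j)‖ ^ 2 = ∑ r, ∑ c, A r c ^ 2 := by
  have h : ∀ j, ‖A.transpose.toEuclideanLin (gramBasis A j)‖ ^ 2 =
      ∑ c, inner ℝ (gramBasis A j) (A.toEuclideanLin (EuclideanSpace.single c 1)) ^ 2 := by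
    intro j
    rw [EuclideanSpace.real_norm_sq_eq]
    refine Finset.sum_congr rfl fun c _ => ?_
    rw [real_inner_comm, inner_toEuclideanLin_transpose, EuclideanSpace.inner_single_left]
    simp
  simp_rw [h]
  rw [Finset.sum_comm, Finset.sum_comm (s := Finset.univ (α := Fin d)) (f := fun r c => A r c ^ 2)]
  refine Finset.sum_congr rfl fun c _ => ?_
  have h2 := (gramBasis A).sum_sq_norm_inner_right
    (A.toEuclideanLin (EuclideanSpace.single c 1))
  simp only [Real.norm_eq_abs, sq_abs] at h2
  rw [h2, EuclideanSpace.real_norm_sq_eq]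
  refine Finset.sum_congr rfl fun r _ => ?_
  simp

/-- A left singular vector is an eigenvector of `A Aᵀ` with eigenvalue `σ²`, hence orthogonal to
every basis vector with another eigenvalue. So repeated singular values add no dimension beyond the
count of basis vectors. -/
lemma topLeftSingularSpan_le {θ : ℝ} (hθ : 0 ≤ θ) : topLeftSingularSpan A θ ≤
    Submodule.span ℝ (((Finset.univ.filter fun j =>
      θ < ‖A.transpose.toEuclideanLin (gramBasis A j)‖).image (gramBasis A) : Finset (Vec d)) :
        Set (Vec d)) := by
  refine Submodule.span_le.2 ?_
  rintro u ⟨σ, hσ, hσ0, hu, w, hw, h1, h2⟩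
  have hgram : gramOp A u = (σ ^ 2) • u := by
    change A.toEuclideanLin (A.transpose.toEuclideanLin u) = _
    rw [h2, map_smul, h1, smul_smul, sq]
  rw [← (gramBasis A).sum_repr' u]
  refine Submodule.sum_mem _ fun j _ => ?_
  by_cases hz : inner ℝ (gramBasis A j) u = (0 : ℝ)
  · rw [hz, zero_smul]; exact Submodule.zero_mem _
  · refine Submodule.smul_mem _ _ (Submodule.subset_span ?_)
    have h3 := gramOp_isSymmetric A (gramBasis A j) u
    rw [hgram, gramOp_gramBasis, real_inner_smul_left, real_inner_smul_right] at h3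
    have h4 := mul_right_cancel₀ hz h3
    have h5 : θ < ‖A.transpose.toEuclideanLin (gramBasis A j)‖ := by
      refine lt_of_pow_lt_pow_left₀ 2 (norm_nonneg _) ?_
      rw [h4]
      exact pow_lt_pow_left₀ hσ hθ two_ne_zero
    simp only [Finset.coe_image, Finset.coe_filter, Finset.mem_univ, true_and]
    exact ⟨j, h5, rfl⟩

lemma finrank_topLeftSingularSpan_mul_sq_le {θ : ℝ} (hθ : 0 ≤ θ) :
    (Module.finrank ℝ (topLeftSingularSpan A θ) : ℝ) * θ ^ 2 ≤ ∑ r, ∑ c, A r c ^ 2 := by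
  set J := Finset.univ.filter fun j => θ < ‖A.transpose.toEuclideanLin (gramBasis A j)‖ with hJ
  have h1 : Module.finrank ℝ (topLeftSingularSpan A θ) ≤ J.card :=
    (Submodule.finrank_mono (topLeftSingularSpan_le A hθ)).trans
      ((finrank_span_finset_le_card _).trans Finset.card_image_le)
  calc (Module.finrank ℝ (topLeftSingularSpan A θ) : ℝ) * θ ^ 2 ≤ (J.card : ℝ) * θ ^ 2 := by
        gcongr
    _ = ∑ j ∈ J, θ ^ 2 := by simp
    _ ≤ ∑ j ∈ J, ‖A.transpose.toEuclideanLin (gramBasis A j)‖ ^ 2 := by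
        refine Finset.sum_le_sum fun j hj => ?_
        have := (Finset.mem_filter.1 hj).2
        gcongr
    _ ≤ ∑ j, ‖A.transpose.toEuclideanLin (gramBasis A j)‖ ^ 2 :=
        Finset.sum_le_sum_of_subset_of_nonneg (Finset.subset_univ _) fun _ _ _ => by positivity
    _ = _ := sum_norm_transpose_gramBasis_sq A

end SingularVectors

/-! ### Correlation with, and dimension of, the Chow subspace. -/

section ChowSubspace

variable {d : ℕ}

lemma norm_transpose_sq_le {ι : Type} [Fintype ι] [DecidableEq ι] (A : Matrix (Fin d) ι ℝ)
    (u : Vec d) :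
    ‖A.transpose.toEuclideanLin u‖ ^ 2 ≤ (∑ r, ∑ c, A r c ^ 2) * ‖u‖ ^ 2 := by
  rw [norm_transpose_sq_eq_sum, ← sum_norm_transpose_gramBasis_sq, Finset.sum_mul]
  refine Finset.sum_le_sum fun j _ => mul_le_mul_of_nonneg_left ?_ (by positivity)
  have h := abs_real_inner_le_norm (gramBasis A j) u
  rw [(gramBasis A).norm_eq_one, one_mul] at h
  exact sq_le_sq.2 (by rwa [abs_norm])

lemma sum_flatten_sq {n : ℕ} (T : Tensor d (n + 1)) :
    ∑ r, ∑ c, T.flatten r c ^ 2 = T.frobNorm ^ 2 := by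
  rw [T.frobNorm_sq, sum_cons]
  rfl

lemma norm_flatten_transpose_le {n : ℕ} (T : Tensor d (n + 1)) (u : Vec d) :
    ‖T.flatten.transpose.toEuclideanLin u‖ ≤ T.frobNorm * ‖u‖ := by
  refine le_of_sq_le_sq ?_ (mul_nonneg T.frobNorm_nonneg (norm_nonneg u))
  rw [mul_pow, ← sum_flatten_sq]
  exact norm_transpose_sq_le _ u

/-- The flattened tensor power `v^{⊗n}`. -/
noncomputable def powVec (v : Vec d) (n : ℕ) : EuclideanSpace ℝ (Fin n → Fin d) :=
  WithLp.toLp 2 fun I => ∏ c, v (I c)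

lemma norm_powVec {v : Vec d} (hv : ‖v‖ = 1) (n : ℕ) : ‖powVec v n‖ = 1 := by
  have h : ‖powVec v n‖ ^ 2 = 1 := by
    rw [EuclideanSpace.real_norm_sq_eq]
    simp only [powVec, ← Finset.prod_pow]
    rw [← Fintype.sum_pow (fun l => v l ^ 2) n, ← EuclideanSpace.real_norm_sq_eq, hv]
    simp
  exact (pow_eq_one_iff_of_nonneg (norm_nonneg _) two_ne_zero).1 h

lemma sum_prod_mul_eq_inner (v : Vec d) {n : ℕ} (T : Tensor d (n + 1)) :
    ∑ i, (∏ c, v (i c)) * T i = inner ℝ (T.flatten.toEuclideanLin (powVec v n)) v := by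
  rw [sum_cons, PiLp.inner_apply]
  refine Finset.sum_congr rfl fun l _ => ?_
  simp only [Fin.prod_univ_succ, Fin.cons_zero, Fin.cons_succ, RCLike.inner_apply, conj_trivial]
  change _ = v l * ∑ I, T.flatten l I * powVec v n I
  rw [Finset.mul_sum]
  refine Finset.sum_congr rfl fun I _ => ?_
  simp only [powVec, Tensor.flatten]
  ring

lemma abs_inner_flatten_le {ι : Type} [Fintype ι] [DecidableEq ι] (A : Matrix (Fin d) ι ℝ)
    {w : EuclideanSpace ℝ ι} (hw : ‖w‖ = 1) (u : Vec d) :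
    |inner ℝ (A.toEuclideanLin w) u| ≤ ‖A.transpose.toEuclideanLin u‖ := by
  rw [inner_toEuclideanLin_transpose]
  refine (abs_real_inner_le_norm _ _).trans ?_
  rw [hw, one_mul]

lemma finrank_iSup_le_sum {k : ℕ} (W : Fin k → Submodule ℝ (Vec d)) :
    Module.finrank ℝ (⨆ n, W n : Submodule ℝ (Vec d)) ≤ ∑ n, Module.finrank ℝ (W n) := by
  rw [← Finset.sup_univ_eq_iSup]
  induction (Finset.univ : Finset (Fin k)) using Finset.induction_on with
  | empty => simp
  | insert a s ha ih =>
    rw [Finset.sup_insert, Finset.sum_insert ha]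
    exact (Submodule.finrank_add_le_finrank_add_finrank _ _).trans (by gcongr)

/-- The correlation with a direction is expressed by the Chow tensors. -/
lemma exists_integral_eq_sum_chowTensor {D : Measure (Vec d × ℝ)} [IsProbabilityMeasure D]
    (hD : D.map Prod.fst = stdGaussian (Vec d)) {k : ℕ} {p : Polynomial ℝ} {v : Vec d}
    (hp : p.natDegree ≤ k) (h0 : ∫ t, p.eval t ∂(gaussianReal 0 1) = 0)
    (h1 : Var[fun t => p.eval t; gaussianReal 0 1] = 1) (hv : ‖v‖ = 1) :
    ∃ b : Fin k → ℝ, ∑ n, b n ^ 2 = 1 ∧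
      ∫ z, negInd z.2 * p.eval (inner ℝ v z.1) ∂D =
        ∑ n : Fin k, b n *
          inner ℝ ((chowTensor D (n + 1)).flatten.toEuclideanLin (powVec v n)) v := by
  obtain ⟨b, hb, hb1⟩ := exists_normalized_hermite_expansion k p hp h0 h1
  refine ⟨b, hb1, ?_⟩
  have hpt : ∀ z : Vec d × ℝ, negInd z.2 * p.eval (inner ℝ v z.1) = ∑ n : Fin k, b n *
      ∑ i : Fin ((n : ℕ) + 1) → Fin d,
        (∏ c, v (i c)) * (negInd z.2 * hermiteTensor (n + 1) z.1 i) := by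
    intro z
    rw [hb, Finset.mul_sum]
    refine Finset.sum_congr rfl fun n _ => ?_
    rw [eval_realHermite_inner v hv, Finset.mul_sum, Finset.mul_sum, Finset.mul_sum]
    exact Finset.sum_congr rfl fun i _ => by ring
  have hint : ∀ (m : ℕ) (i : Fin m → Fin d),
      Integrable (fun z : Vec d × ℝ => negInd z.2 * hermiteTensor m z.1 i) D := by
    intro m i
    refine ((integrable_negInd_mul hD (hermPoly (indexCount i))).const_mul
      (1 / √(m.factorial : ℝ))).congr (Filter.Eventually.of_forall fun z => ?_)
    simp only [hermiteTensor_eq]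
    ring
  simp_rw [hpt]
  rw [integral_finsetSum _ fun n _ => Integrable.const_mul
    (integrable_finsetSum _ fun i _ => (hint _ i).const_mul _) _]
  refine Finset.sum_congr rfl fun n _ => ?_
  rw [integral_const_mul, integral_finsetSum _ fun i _ => (hint _ i).const_mul _,
    ← sum_prod_mul_eq_inner]
  simp_rw [integral_const_mul]
  rfl

/-- A direction that correlates with the Chow tensors has a large projection to the subspace
spanned by the singular vectors of approximate Chow tensors. -/
lemma correlation_le {k : ℕ} (hk : 0 < k) {v : Vec d} (hv : ‖v‖ = 1) {b : Fin k → ℝ}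
    (hb : ∑ n, b n ^ 2 = 1) {τ B : ℝ} (hτ : 0 < τ) {S T : (m : ℕ) → Tensor d m}
    (hS : ∀ n : Fin k, (S (n + 1)).frobNorm ≤ B)
    (hT : ∀ n : Fin k, (T (n + 1) - S (n + 1)).frobNorm ≤ τ / (4 * √(k : ℝ)))
    (hcorr : τ ≤ ∑ n : Fin k, b n *
      inner ℝ ((S (n + 1)).flatten.toEuclideanLin (powVec v n)) v) :
    τ ≤ 4 * √(k : ℝ) * B *
      ‖(chowSubspace T k (τ / (4 * √(k : ℝ)))).starProjection v‖ := by
  have hk0 : (0 : ℝ) < √(k : ℝ) := Real.sqrt_pos.2 (by exact_mod_cast hk)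
  set θ := τ / (4 * √(k : ℝ)) with hθ
  have hθ0 : 0 < θ := by positivity
  set V := chowSubspace T k θ with hV
  set u := V.starProjection v with hu
  have hperp : v - u ∈ Vᗮ := Submodule.sub_starProjection_mem_orthogonal v
  have hu1 : ‖u‖ ≤ 1 := hv ▸ V.norm_starProjection_apply_le v
  have hperp1 : ‖v - u‖ ≤ 1 := by
    have h := V.norm_sq_eq_add_norm_sq_starProjection v
    rw [hv, Submodule.starProjection_orthogonal_val] at h
    change (1 : ℝ) ^ 2 = ‖u‖ ^ 2 + ‖v - u‖ ^ 2 at h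
    nlinarith [norm_nonneg (v - u), sq_nonneg ‖u‖]
  -- Split `v = u + (v - u)` and write `S = T - (T - S)` on the second part. The three pieces cost
  -- `B ‖u‖`, `θ` (small singular values) and `θ` (approximation error); `3θ` leaves slack.
  have hterm : ∀ n : Fin k,
      |inner ℝ ((S (n + 1)).flatten.toEuclideanLin (powVec v n)) v| ≤ 3 * θ + B * ‖u‖ := by
    intro n
    set w := powVec v n
    have hw : ‖w‖ = 1 := norm_powVec hv n
    have hflat : (S (n + 1)).flatten.toEuclideanLin w =
        (T (n + 1)).flatten.toEuclideanLin w -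
          (T (n + 1) - S (n + 1)).flatten.toEuclideanLin w := by
      have : (T (n + 1) - S (n + 1)).flatten = (T (n + 1)).flatten - (S (n + 1)).flatten := rfl
      rw [this, map_sub, LinearMap.sub_apply]
      abel
    have hsplit : inner ℝ ((S (n + 1)).flatten.toEuclideanLin w) v =
        inner ℝ ((S (n + 1)).flatten.toEuclideanLin w) u +
        inner ℝ ((T (n + 1)).flatten.toEuclideanLin w) (v - u) -
        inner ℝ ((T (n + 1) - S (n + 1)).flatten.toEuclideanLin w) (v - u) := by
      have hvu : inner ℝ ((S (n + 1)).flatten.toEuclideanLin w) v =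
          inner ℝ ((S (n + 1)).flatten.toEuclideanLin w) u +
          inner ℝ ((S (n + 1)).flatten.toEuclideanLin w) (v - u) := by
        rw [← inner_add_right, add_sub_cancel]
      rw [hvu, add_sub_assoc, ← inner_sub_left, ← hflat]
    have h1 := (abs_inner_flatten_le (S (n + 1)).flatten hw u).trans
      (norm_flatten_transpose_le _ u)
    have h2 := (abs_inner_flatten_le (T (n + 1)).flatten hw (v - u)).trans
      (norm_transpose_le_of_mem_orthogonal _ hθ0.le (Submodule.orthogonal_le
        (le_iSup (fun n : Fin k => topLeftSingularSpan (T (n + 1)).flatten θ) n) hperp))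
    have h3 := (abs_inner_flatten_le (T (n + 1) - S (n + 1)).flatten hw (v - u)).trans
      (norm_flatten_transpose_le _ (v - u))
    have h4 : (S (n + 1)).frobNorm * ‖u‖ ≤ B * ‖u‖ := by gcongr; exact hS n
    have h5 : θ * ‖v - u‖ ≤ θ := mul_le_of_le_one_right hθ0.le hperp1
    have h6 : (T (n + 1) - S (n + 1)).frobNorm * ‖v - u‖ ≤ θ :=
      (mul_le_of_le_one_right (Tensor.frobNorm_nonneg _) hperp1).trans (hT n)
    rw [hsplit]
    refine (abs_sub _ _).trans ?_
    have h7 := abs_add_le (inner ℝ ((S (n + 1)).flatten.toEuclideanLin w) u)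
      (inner ℝ ((T (n + 1)).flatten.toEuclideanLin w) (v - u))
    linarith
  -- Cauchy–Schwarz with `∑ b_n² = 1`.
  have hsumb : ∑ n, |b n| ≤ √(k : ℝ) := by
    refine Real.le_sqrt_of_sq_le ?_
    have h := sq_sum_le_card_mul_sum_sq (s := Finset.univ) (f := fun n => |b n|)
    simp only [sq_abs, hb, Finset.card_univ, Fintype.card_fin, mul_one] at h
    exact h
  have hB : 0 ≤ B := (Tensor.frobNorm_nonneg _).trans (hS ⟨0, hk⟩)
  have hfin : τ ≤ √(k : ℝ) * (3 * θ + B * ‖u‖) := by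
    refine hcorr.trans ?_
    calc _ ≤ ∑ n, |b n| * (3 * θ + B * ‖u‖) := by
          refine Finset.sum_le_sum fun n _ => (le_abs_self _).trans ?_
          rw [abs_mul]
          exact mul_le_mul_of_nonneg_left (hterm n) (abs_nonneg _)
      _ = (∑ n, |b n|) * (3 * θ + B * ‖u‖) := by rw [Finset.sum_mul]
      _ ≤ _ := mul_le_mul_of_nonneg_right hsumb (by positivity)
  have hθk : √(k : ℝ) * θ = τ / 4 := by rw [hθ]; field_simp
  nlinarith

lemma finrank_chowSubspace_le {k : ℕ} {θ B : ℝ} (hθ : 0 < θ) {S T : (m : ℕ) → Tensor d m}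
    (hS : ∀ n : Fin k, (S (n + 1)).frobNorm ≤ B)
    (hT : ∀ n : Fin k, (T (n + 1) - S (n + 1)).frobNorm ≤ θ) :
    (Module.finrank ℝ (chowSubspace T k θ) : ℝ) ≤ k * (2 * B ^ 2 / θ ^ 2 + 2) := by
  have hterm : ∀ n : Fin k,
      (Module.finrank ℝ (topLeftSingularSpan (T (n + 1)).flatten θ) : ℝ) ≤
        2 * B ^ 2 / θ ^ 2 + 2 := by
    intro n
    have h1 := finrank_topLeftSingularSpan_mul_sq_le (T (n + 1)).flatten hθ.le
    rw [sum_flatten_sq] at h1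
    have h2 : (T (n + 1)).frobNorm ^ 2 ≤
        2 * (S (n + 1)).frobNorm ^ 2 + 2 * (T (n + 1) - S (n + 1)).frobNorm ^ 2 := by
      simp only [Tensor.frobNorm_sq, Finset.mul_sum, ← Finset.sum_add_distrib, Pi.sub_apply]
      refine Finset.sum_le_sum fun i _ => ?_
      nlinarith [sq_nonneg (T (n + 1) i - 2 * S (n + 1) i)]
    have h3 := pow_le_pow_left₀ (Tensor.frobNorm_nonneg _) (hS n) 2
    have h4 := pow_le_pow_left₀ (Tensor.frobNorm_nonneg _) (hT n) 2
    have h5 : 2 * B ^ 2 / θ ^ 2 + 2 = (2 * B ^ 2 + 2 * θ ^ 2) / θ ^ 2 := by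
      field_simp
    rw [h5, le_div_iff₀ (by positivity)]
    linarith
  have h := finrank_iSup_le_sum fun n : Fin k => topLeftSingularSpan (T (n + 1)).flatten θ
  calc (Module.finrank ℝ (chowSubspace T k θ) : ℝ) ≤
      ∑ n : Fin k, (Module.finrank ℝ (topLeftSingularSpan (T (n + 1)).flatten θ) : ℝ) := by
        exact_mod_cast h
    _ ≤ ∑ _n : Fin k, (2 * B ^ 2 / θ ^ 2 + 2) := Finset.sum_le_sum fun n _ => hterm n
    _ = _ := by simp [mul_add]

end ChowSubspace

/-! ### The main theorem. -/

theorem mainTheorem6 :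
    ∃ C c : ℝ, 0 < C ∧ 0 < c ∧
      ∀ (d k : ℕ) (D : Measure (Vec d × ℝ)) [IsProbabilityMeasure D],
        (∀ᵐ z ∂D, z.2 = 1 ∨ z.2 = -1) →
        D.map Prod.fst = stdGaussian (Vec d) →
        ∀ (p : Polynomial ℝ) (v : Vec d) (τ : ℝ) (T' : (m : ℕ) → Tensor d m),
          p.natDegree ≤ k →
          ∫ t, p.eval t ∂(gaussianReal 0 1) = 0 →
          Var[fun t => p.eval t; gaussianReal 0 1] = 1 →
          ‖v‖ = 1 →
          0 < τ → τ ≤ 1 →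
          τ ≤ ∫ z, negInd z.2 * p.eval (inner ℝ v z.1) ∂D →
          (∀ m, 1 ≤ m → m ≤ k → (T' m - chowTensor D m).frobNorm ≤ τ / (4 * √(k : ℝ))) →
          ∀ (γ L : ℝ) (V : Submodule ℝ (Vec d)),
            γ = D.real {z | z.2 = -1} →
            L = max 1 (Real.log (1 / γ)) →
            V = chowSubspace T' k (τ / (4 * √(k : ℝ))) →
            (Module.finrank ℝ V : ℝ) ≤ C * (γ ^ 2 * L ^ k * (k : ℝ) ^ 2 / τ ^ 2 + 1) ∧
            c * (τ / (√(k : ℝ) * γ * L ^ ((k : ℝ) / 2))) ≤ ‖V.starProjection v‖ := by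
  refine ⟨64 * Real.exp 3, (4 * Real.exp (3 / 2))⁻¹, by positivity, by positivity, ?_⟩
  intro d k D _ _ hD p v τ T' hp h0 h1 hv hτ _ hcorr hT' γ L V hγ hL hV
  obtain ⟨b, hb, hsum⟩ := exists_integral_eq_sum_chowTensor hD hp h0 h1 hv
  -- For `k = 0` the sum of squares is empty and cannot equal one.
  have hk : 0 < k := by
    rcases Nat.eq_zero_or_pos k with rfl | h
    · simp at hb
    · exact h
  have hk0 : (0 : ℝ) < k := by exact_mod_cast hk
  have hL1 : 1 ≤ L := hL ▸ le_max_left _ _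
  have hγ0 : 0 < γ := by
    refine lt_of_le_of_ne (hγ ▸ measureReal_nonneg) fun h => ?_
    have hzero : ∫ z, negInd z.2 * p.eval (inner ℝ v z.1) ∂D = 0 := by
      have hnull : D {z | z.2 = -1} = 0 := by
        rw [← measureReal_eq_zero_iff, ← hγ, ← h]
      have hae : ∀ᵐ z ∂D, ¬ z.2 = -1 := by
        rw [ae_iff]; simpa using hnull
      refine integral_eq_zero_of_ae (hae.mono fun z hz => ?_)
      simp [negInd, hz]
    linarith
  set R := L ^ ((k : ℝ) / 2) with hR
  have hR0 : 0 < R := Real.rpow_pos_of_pos (by linarith) _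
  have hRsq : R ^ 2 = L ^ k := by
    rw [hR, ← Real.rpow_natCast, ← Real.rpow_mul (by linarith), ← Real.rpow_natCast]
    congr 1
    push_cast; ring
  -- The square root of the level bound at `m = k`; it serves every `m ≤ k` because `L ≥ 1`.
  set B := Real.exp (3 / 2) * γ * R with hB
  have hBsq : B ^ 2 = Real.exp 3 * γ ^ 2 * L ^ k := by
    rw [hB, mul_pow, mul_pow, hRsq, ← Real.exp_nat_mul]
    norm_num
  have hS : ∀ n : Fin k, (chowTensor D (n + 1)).frobNorm ≤ B := by
    intro n
    refine le_of_sq_le_sq ?_ (by positivity)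
    have h := frobNorm_chowTensor_sq_le hD ((n : ℕ) + 1) (L := L) (hγ ▸ hγ0) (by rw [← hγ]; exact hL)
    rw [← hγ] at h
    rw [hBsq]
    refine h.trans (mul_le_mul_of_nonneg_left ?_ (by positivity))
    exact pow_le_pow_right₀ hL1 n.isLt
  have hT : ∀ n : Fin k, (T' (n + 1) - chowTensor D (n + 1)).frobNorm ≤ τ / (4 * √(k : ℝ)) :=
    fun n => hT' _ (Nat.le_add_left _ _) n.isLt
  have hsk : (0 : ℝ) < √(k : ℝ) := Real.sqrt_pos.2 hk0
  have hproj := correlation_le hk hv hb hτ hS hT (hsum ▸ hcorr)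
  have hdim := finrank_chowSubspace_le (by positivity : 0 < τ / (4 * √(k : ℝ))) hS hT
  rw [← hV] at hproj hdim
  constructor
  -- The projection bound with `‖proj_V v‖ ≤ 1` forces `B` to be large enough that the additive `2k`
  -- in the dimension count is absorbed by the main term, at the price of doubling `32` to `64`.
  · have hτB : τ ≤ 4 * √(k : ℝ) * B := by
      refine hproj.trans (mul_le_of_le_one_right (by positivity) ?_)
      exact hv ▸ V.norm_starProjection_apply_le v
    have hτ2 : τ ^ 2 ≤ 16 * k * B ^ 2 := by
      refine (pow_le_pow_left₀ hτ.le hτB 2).trans (le_of_eq ?_)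
      rw [mul_pow, mul_pow, Real.sq_sqrt hk0.le]
      ring
    have hk2 : 2 * (k : ℝ) ≤ 32 * k ^ 2 * B ^ 2 / τ ^ 2 := by
      rw [le_div_iff₀ (by positivity)]
      nlinarith
    have hθ2 : (k : ℝ) * (2 * B ^ 2 / (τ / (4 * √(k : ℝ))) ^ 2 + 2) =
        32 * k ^ 2 * B ^ 2 / τ ^ 2 + 2 * k := by
      rw [div_pow, mul_pow 4, Real.sq_sqrt hk0.le]
      field_simp
      ring
    calc (Module.finrank ℝ V : ℝ) ≤ 64 * k ^ 2 * B ^ 2 / τ ^ 2 := by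
          rw [hθ2] at hdim
          refine hdim.trans ((add_le_add_right hk2 _).trans (le_of_eq ?_))
          ring
      _ = 64 * Real.exp 3 * (γ ^ 2 * L ^ k * (k : ℝ) ^ 2 / τ ^ 2) := by rw [hBsq]; ring
      _ ≤ _ := by
          refine mul_le_mul_of_nonneg_left ?_ (by positivity)
          linarith
  · rw [← div_eq_inv_mul, div_div, div_le_iff₀ (by positivity)]
    refine hproj.trans (le_of_eq ?_)
    rw [hB]
    ring
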